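/- Let $m\in\mathbb N^*=\{1,2,\dots\}$ and let $K_m$ be the weights on the half-line $\mathbb N^*$ given by $K_m(i,i+1)=K_m(i+1,i)=m$ for $i\ge 1$, all other entries being zero. Let $\beta=(\beta_i)_{i\in\mathbb N^*}$ be a random field with law $\nu_{\mathbb N^*}^{K_m}$, i.e. $\beta_i\ge 0$ almost surely and, for every finite $S\subset\mathbb N^*$ and $t\in\mathbb R_+^S$, $$\mathbb E\Big[e^{-\sum_{i\in S}t_i\beta_i}\Big]=\exp\Big(-\tfrac12\sum_{i,j\in S}K_m(i,j)\big(\sqrt{(1+t_i)(1+t_j)}-1\big)-\sum_{i\in S,\,j\notin S}K_m(i,j)\big(\sqrt{1+t_i}-1\big)\Big)\prod_{i\in S}\frac1{\sqrt{1+t_i}} .$$ (The sum over $i,j\in S$ is over ordered pairs.) Let $H_\beta(i,j)=2\beta_i\mathbf 1\{i=j\}-K_m(i,j)$, let $\hat G^{(n,m)}$ be the inverse of the restriction of $H_\beta$ to $\{1,\dots,n\}$, and for $n\in\mathbb N^*$ put $$\psi^{(n,m)}=m\,\hat G^{(n,m)}(1,n),\qquad Z^{(n,m)}=\frac{\hat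 G^{(n,m)}(1,1)}{\psi^{(n,m)}},$$ $$\mathcal A_{n,m}=\sigma(\psi^{(k,m)},1\le k\le n),\qquad \mathcal Z_{n,m}=\sigma(Z^{(k,m)},1\le k\le n).$$ Let $IG(\mu,\lambda)$ denote the Inverse Gaussian distribution, with density $\mathbf 1\{x>0\}\sqrt{\lambda/(2\pi x^3)}\,e^{-\lambda(x-\mu)^2/(2\mu^2x)}$. Then, almost surely, the restrictions of $H_\beta$ to $\{1,\dots,n\}$ are positive definite for all $n\in\mathbb N^*$ (so that the objects above are well defined), and: (i) For every $n\in\mathbb N^*$, $\mathcal Z_{n,m}\subsetneq\mathcal A_{n,m}$. Here the $\sigma$-fields may be taken either as their traces on the almost sure event where all these restrictions are positive definite, or up to null sets; the inclusion is strict in both senses. (ii) $(Z^{(n,m)})_{n\in\mathbb N^*}$ is a Markov process in its own filtration. More precisely, for every $n\in\mathbb N^*$, the law of $Z^{(n+1,m)}$ conditionally on $\mathcal Z_{n,m}$ is the law of $\frac{Z^{(n,m)}}{m}\cdot\frac1X$, where, given $\mathcal Z_{n,m}$, $X\sim IG\Big(\frac{1}{m+1/Z^{(n,m)}},1\Big)$.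 (iii) For every $n\in\mathbb N^*$, the conditional law of $\psi^{(n,m)}$ given $\mathcal Z_{n,m}$ is $IG(1,1/Z^{(n,m)})$, i.e. it has density $$\mathbf 1\{x>0\}\frac{1}{\sqrt{2\pi Z^{(n,m)}x^3}}\,e^{-\frac{1}{Z^{(n,m)}}\frac{(x-1)^2}{2x}} .$$ -/

import Mathlib

open MeasureTheory

/-- The Inverse Gaussian distribution `IG(μ, lam)`: the measure on `ℝ` with density
`1_{x > 0} √lam / √(2 π x³) exp (- lam (x - μ)² / (2 x μ²))` with respect to Lebesgue measure. -/
noncomputable def inverseGaussian (μ lam : ℝ) : Measure ℝ :=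
  volume.withDensity fun x =>
    ENNReal.ofReal
      (if 0 < x then
        √lam / √(2 * Real.pi * x ^ 3) * Real.exp (-(lam * (x - μ) ^ 2 / (2 * x * μ ^ 2)))
      else 0)

section BetaPotential

variable {V : Type*} [DecidableEq V]

/-- The Schrödinger operator `H_β(i, j) = 1_{i = j} 2 β_i - W_{i,j}` on the vertex set `V`. -/
def schrodinger (W : V → V → ℝ) (β : V → ℝ) : Matrix V V ℝ :=
  Matrix.of fun i j => (if i = j then 2 * β i else 0) - W i j

/-- `ν` is the infinite-volume law `ν_V^W` of the random potential `β` on the locally finite graph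
with vertex set `V` and symmetric non-negative weights `W` (an edge is a pair of positive weight):
the probability measure on `ℝ₊^V` whose Laplace transform on every finite set `S` of vertices and
for every `t ∈ ℝ₊^S` is
`exp (- ∑_{edges {i,j} in S} W_{i,j} (√((t_i+1)(t_j+1)) - 1)
      - ∑_{i ∈ S, j ∉ S} W_{i,j} (√(t_i+1) - 1)) ∏_{i ∈ S} 1/√(1+t_i)`.
The factor `1/2` below goes with the sum over ordered pairs, which meets each edge twice. -/
structure IsBetaLaw (W : V → V → ℝ) (ν : Measure (V → ℝ)) : Prop where
  isProbabilityMeasure : IsProbabilityMeasure ν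
  nonneg : ∀ i, ∀ᵐ β ∂ν, 0 ≤ β i
  laplace : ∀ (S : Finset V) (t : V → ℝ), (∀ i ∈ S, 0 ≤ t i) →
    ∫ β, Real.exp (-∑ i ∈ S, t i * β i) ∂ν =
      Real.exp
        (-(1 / 2 * ∑ i ∈ S, ∑ j ∈ S, W i j * (√((t i + 1) * (t j + 1)) - 1))
          - ∑ i ∈ S, (∑' j, if j ∈ S then 0 else W i j) * (√(t i + 1) - 1))
      * ∏ i ∈ S, 1 / √(1 + t i)

end BetaPotential

section HalfLine

/-- The weights `K_m` on the half-line `ℕ* = {1, 2, …}`: weight `m` between neighbours,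
all other entries zero. -/
def lineWeight (m : ℝ) (i j : ℕ+) : ℝ :=
  if j = i + 1 ∨ i = j + 1 then m else 0

/-- The restriction of `H_β^{(m)}` to the vertices `1, …, n`. -/
def boxOperator (m : ℝ) (β : ℕ+ → ℝ) (n : ℕ+) :
    Matrix (Set.Icc (1 : ℕ+) n) (Set.Icc (1 : ℕ+) n) ℝ :=
  (schrodinger (lineWeight m) β).submatrix Subtype.val Subtype.val

/-- The Green function `Ĝ^{(n,m)}`, inverse of the restriction of `H_β^{(m)}` to `1, …, n`. -/
noncomputable def greenHat (m : ℝ) (β : ℕ+ → ℝ) (n : ℕ+) :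
    Matrix (Set.Icc (1 : ℕ+) n) (Set.Icc (1 : ℕ+) n) ℝ :=
  (boxOperator m β n)⁻¹

/-- `ψ^{(n,m)} = m Ĝ^{(n,m)}(1, n)`. -/
noncomputable def psi (m : ℝ) (β : ℕ+ → ℝ) (n : ℕ+) : ℝ :=
  greenHat m β n ⟨1, le_refl 1, one_le⟩ ⟨n, one_le, le_refl n⟩ * m

/-- `Z^{(n,m)} = Ĝ^{(n,m)}(1, 1) / ψ^{(n,m)}`. -/
noncomputable def zRatio (m : ℝ) (β : ℕ+ → ℝ) (n : ℕ+) : ℝ :=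
  greenHat m β n ⟨1, le_refl 1, one_le⟩ ⟨1, le_refl 1, one_le⟩ / psi m β n

end HalfLine

section Processes

variable {Ω : Type*}

/-- The σ-field `σ(X_k, 1 ≤ k ≤ n)`. -/
abbrev history (X : ℕ+ → Ω → ℝ) (n : ℕ+) : MeasurableSpace Ω :=
  ⨆ (k : ℕ+) (_ : k ≤ n), MeasurableSpace.comap (X k) inferInstance

/-- The trace on the event `E` of the σ-field `𝓖`. -/
abbrev traceOn (𝓖 : MeasurableSpace Ω) (E : Set Ω) : MeasurableSpace E :=
  MeasurableSpace.comap Subtype.val 𝓖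

variable [MeasurableSpace Ω]

/-- The random measure `κ` is the conditional law of `X` given the σ-field `𝓖`:
`P(X ∈ B | 𝓖) = κ(B)` almost surely, for every Borel set `B`. -/
def HasCondLaw (P : Measure Ω) (𝓖 : MeasurableSpace Ω) (X : Ω → ℝ) (κ : Ω → Measure ℝ) : Prop :=
  ∀ B : Set ℝ, MeasurableSet B →
    P[(X ⁻¹' B).indicator (fun _ => (1 : ℝ)) | 𝓖] =ᵐ[P] fun ω => (κ ω).real B

/-- The discrete-time process `X` is a Markov process in its own filtration. -/
def IsMarkovProcess (P : Measure Ω) (X : ℕ+ → Ω → ℝ) : Prop :=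
  (∀ n, Measurable (X n)) ∧
  ∀ (n : ℕ+) (B : Set ℝ), MeasurableSet B →
    P[(X (n + 1) ⁻¹' B).indicator (fun _ => (1 : ℝ)) | history X n] =ᵐ[P]
      P[(X (n + 1) ⁻¹' B).indicator (fun _ => (1 : ℝ)) |
        MeasurableSpace.comap (X n) inferInstance]

end Processes

/-! Eliminate from vertex `1` onwards: the restriction of `H_β` has pivots `d_0 = 2β_1`, `d_{k+1} =
2β_{k+2} - m²/d_k`. Put `x_k = m/d_k`. All restrictions are positive definite exactly when every
`x_k > 0` (`posDef_boxOperator_iff`), and then, with `P_n = x_0 ⋯ x_{n-1}`, solving for the first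
column of the inverse gives `ψ_n = P_n` and `Z_n = (∑_{k<n} P_k P_{k+1}) / (m P_n)`. Hence `ψ_{n+1}
= ψ_n x_n` and `Z_{n+1} = Z_n/x_n + ψ_n/m`.

The `x_k` are independent with law `IG(1, m)` (`IsBetaLaw.map_pivotRatio`). Indeed `2β_{k+1} = m/x_k
+ m x_{k-1}`, so for such `x_k` the Laplace transform of `β` is a product of transforms of the pairs
`(x_k, 1/x_k)`, which is the prescribed one; Laplace transforms determine laws on nonnegative
sequences (`ext_of_forall_integral_exp_neg`).

The core is the exchange identity `lintegral_inverseGaussian_exchange`. If, given the past of `Z`,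
`ψ_n` is `IG(1, 1/Z_n)`, then it is independent of `x_n`, and the pair `(Z_{n+1}, ψ_{n+1})` has an
explicit law: `Z_{n+1}` follows the announced transition, and given it `ψ_{n+1}` is `IG(1,
1/Z_{n+1})`. So the conditional law of `ψ_n` propagates by induction from `Z_1 = 1/m`, `ψ_1 = x_0`,
and the Markov property comes with it.

`Z_k` is a function of `ψ_1, …, ψ_k`, which gives the inclusion of σ-fields. It is strict because,
given the past of `Z`, `ψ_n` charges both sides of `1`, so `{ψ_n > 1}` is not an event of that past,
even up to null sets. -/

/-! ### The Inverse Gaussian distribution: total mass and Laplace transform. -/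

/-- The density of the Inverse Gaussian distribution `IG(μ, lam)`. -/
noncomputable def igDensity (μ lam x : ℝ) : ℝ :=
  if 0 < x then
    √lam / √(2 * Real.pi * x ^ 3) * Real.exp (-(lam * (x - μ) ^ 2 / (2 * x * μ ^ 2)))
  else 0

theorem inverseGaussian_eq (μ lam : ℝ) :
    inverseGaussian μ lam = volume.withDensity fun x => ENNReal.ofReal (igDensity μ lam x) := rfl

theorem igDensity_of_pos {x : ℝ} (μ lam : ℝ) (hx : 0 < x) : igDensity μ lam x =
    √lam / √(2 * Real.pi * x ^ 3) * Real.exp (-(lam * (x - μ) ^ 2 / (2 * x * μ ^ 2))) := if_pos hx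

theorem igDensity_nonneg (μ lam x : ℝ) : 0 ≤ igDensity μ lam x := by
  unfold igDensity; split_ifs <;> positivity

theorem igDensity_pos {μ lam x : ℝ} (hl : 0 < lam) (hx : 0 < x) : 0 < igDensity μ lam x := by
  rw [igDensity_of_pos _ _ hx]; positivity

theorem measurable_igDensity :
    Measurable fun q : ℝ × ℝ × ℝ => igDensity q.1 q.2.1 q.2.2 := by
  unfold igDensity
  refine Measurable.ite (measurableSet_lt measurable_const (by fun_prop)) ?_ measurable_const
  fun_prop

theorem measurable_igDensity_right (μ lam : ℝ) : Measurable (igDensity μ lam) :=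
  measurable_igDensity.comp (by fun_prop : Measurable fun x : ℝ => (μ, lam, x))

theorem lintegral_inverseGaussian (μ lam : ℝ) {f : ℝ → ENNReal} (hf : Measurable f) :
    ∫⁻ x, f x ∂inverseGaussian μ lam =
      ∫⁻ x in Set.Ioi 0, ENNReal.ofReal (igDensity μ lam x) * f x := by
  rw [inverseGaussian_eq, lintegral_withDensity_eq_lintegral_mul _
    (measurable_igDensity_right μ lam).ennreal_ofReal hf, ← lintegral_indicator measurableSet_Ioi]
  congr 1
  ext x
  by_cases hx : 0 < x
  · simp [hx]
  · simp [hx, igDensity]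

theorem sqrt_two_pi_cube {x : ℝ} (hx : 0 < x) :
    √(2 * Real.pi * x ^ 3) = √(2 * Real.pi) * (x * √x) := by
  rw [Real.sqrt_mul (by positivity), show x ^ 3 = x ^ 2 * x by ring,
    Real.sqrt_mul (sq_nonneg x), Real.sqrt_sq hx.le]

/-- The substitution `y = a² / x` exchanges the two summands of the Gaussian change of variable. -/
theorem lintegral_mul_igDensity {μ lam : ℝ} (hμ : 0 < μ) :
    ∫⁻ x in Set.Ioi 0, ENNReal.ofReal (x / μ * igDensity μ lam x) =
      ∫⁻ x in Set.Ioi 0, ENNReal.ofReal (igDensity μ lam x) := by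
  have himg : (fun y : ℝ => μ ^ 2 / y) '' Set.Ioi 0 = Set.Ioi 0 := by
    ext x
    simp only [Set.mem_image, Set.mem_Ioi]
    constructor
    · rintro ⟨y, hy, rfl⟩; positivity
    · intro hx; exact ⟨μ ^ 2 / x, by positivity, by field_simp⟩
  have hinj : Set.InjOn (fun y : ℝ => μ ^ 2 / y) (Set.Ioi 0) := by
    intro a ha b hb h
    simp only [Set.mem_Ioi] at ha hb h
    field_simp at h
    exact h.symm
  have hder : ∀ y ∈ Set.Ioi (0 : ℝ), HasDerivWithinAt (fun y : ℝ => μ ^ 2 / y)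
      (-(μ ^ 2 / y ^ 2)) (Set.Ioi 0) y := by
    intro y hy
    have h := (hasDerivAt_inv (ne_of_gt hy)).const_mul (μ ^ 2)
    refine (h.congr_deriv ?_).hasDerivWithinAt
    rw [div_eq_mul_inv]; ring
  rw [← himg, lintegral_image_eq_lintegral_abs_deriv_mul measurableSet_Ioi hder hinj, himg]
  refine setLIntegral_congr_fun measurableSet_Ioi fun y hy => ?_
  simp only [Set.mem_Ioi] at hy
  rw [← ENNReal.ofReal_mul (abs_nonneg _)]
  congr 1
  have h2 : 0 < μ ^ 2 / y := by positivity
  rw [igDensity_of_pos _ _ h2, igDensity_of_pos _ _ hy, abs_neg, abs_of_pos (by positivity),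
    sqrt_two_pi_cube hy, sqrt_two_pi_cube h2, Real.sqrt_div (by positivity), Real.sqrt_sq hμ.le]
  have : lam * (μ ^ 2 / y - μ) ^ 2 / (2 * (μ ^ 2 / y) * μ ^ 2) =
      lam * (y - μ) ^ 2 / (2 * y * μ ^ 2) := by field_simp; ring
  rw [this]
  have hs : √y ≠ 0 := (Real.sqrt_pos.2 hy).ne'
  have hss : √y ^ 2 = y := Real.sq_sqrt hy.le
  field_simp
  rw [hss, mul_comm]

/-- The map `u = √lam (√x/μ - 1/√x)` sends `(0, ∞)` bijectively onto the line and turns the exponent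
into `-u²/2`. Its derivative has two terms, so the Gaussian integral becomes `√(2π)/2` times the sum
of the integrals of the density and of `x/μ` times the density; these two are equal by
`lintegral_mul_igDensity`. -/
theorem lintegral_igDensity {μ lam : ℝ} (hμ : 0 < μ) (hl : 0 < lam) :
    ∫⁻ x in Set.Ioi 0, ENNReal.ofReal (igDensity μ lam x) = 1 := by
  have hsl : 0 < √lam := Real.sqrt_pos.2 hl
  have himg : (fun x : ℝ => √lam * (√x / μ - (√x)⁻¹)) '' Set.Ioi 0 = Set.univ := by
    refine Set.eq_univ_of_forall fun u => ?_
    set v := u / √lam with hv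
    have h1 : |v| < √(v ^ 2 + 4 / μ) := by
      rw [← Real.sqrt_sq_eq_abs]; exact Real.sqrt_lt_sqrt (sq_nonneg _) (by simp; positivity)
    -- `s = √x` is the positive root of `s² = μ (v s + 1)`, that is, of `s/μ - 1/s = v`.
    set s := μ * (v + √(v ^ 2 + 4 / μ)) / 2 with hs
    have hspos : 0 < s := by
      have := neg_abs_le v
      have : 0 < v + √(v ^ 2 + 4 / μ) := by linarith
      positivity
    have hq : s ^ 2 = μ * (v * s + 1) := by
      have : √(v ^ 2 + 4 / μ) ^ 2 = v ^ 2 + 4 / μ := Real.sq_sqrt (by positivity)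
      rw [hs]
      have h4 : μ * (4 / μ) = 4 := by field_simp
      linear_combination μ ^ 2 / 4 * this + μ / 4 * h4
    refine ⟨s ^ 2, by simpa using by positivity, ?_⟩
    simp only [Real.sqrt_sq hspos.le]
    have : s / μ - s⁻¹ = v := by
      field_simp
      linarith
    rw [this, hv]
    field_simp
  have hinj : Set.InjOn (fun x : ℝ => √lam * (√x / μ - (√x)⁻¹)) (Set.Ioi 0) := by
    apply StrictMonoOn.injOn
    intro a ha b hb hab
    simp only [Set.mem_Ioi] at ha hb
    have h1 : √a < √b := Real.sqrt_lt_sqrt ha.le hab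
    have h0 : 0 < √a := Real.sqrt_pos.2 ha
    have h2 : (√b)⁻¹ < (√a)⁻¹ := inv_strictAnti₀ h0 h1
    have h3 : √a / μ < √b / μ := by gcongr
    simp only
    gcongr
  have hder : ∀ x ∈ Set.Ioi (0 : ℝ), HasDerivWithinAt (fun x : ℝ => √lam * (√x / μ - (√x)⁻¹))
      (√lam * (1 / (2 * √x) / μ + 1 / (2 * √x) / (√x) ^ 2)) (Set.Ioi 0) x := by
    intro x hx
    have h := Real.hasDerivAt_sqrt (ne_of_gt hx)
    have hne : √x ≠ 0 := (Real.sqrt_pos.2 hx).ne'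
    refine ((((h.div_const μ).sub (h.fun_inv hne)).const_mul √lam).congr_deriv ?_).hasDerivWithinAt
    ring
  have hG : ∫⁻ u : ℝ, ENNReal.ofReal (Real.exp (-(1 / 2) * u ^ 2)) =
      ENNReal.ofReal √(2 * Real.pi) := by
    rw [← ofReal_integral_eq_lintegral_ofReal (integrable_exp_neg_mul_sq (by norm_num))
      (ae_of_all _ fun _ => (Real.exp_pos _).le), integral_gaussian]
    congr 2; ring
  have key : ∀ x ∈ Set.Ioi (0 : ℝ),
      ENNReal.ofReal |√lam * (1 / (2 * √x) / μ + 1 / (2 * √x) / (√x) ^ 2)| *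
        ENNReal.ofReal (Real.exp (-(1 / 2) * (√lam * (√x / μ - (√x)⁻¹)) ^ 2)) =
      ENNReal.ofReal (√(2 * Real.pi) / 2) * (ENNReal.ofReal (igDensity μ lam x) +
        ENNReal.ofReal (x / μ * igDensity μ lam x)) := by
    intro x hx
    simp only [Set.mem_Ioi] at hx
    have hs : 0 < √x := Real.sqrt_pos.2 hx
    have hss : √x ^ 2 = x := Real.sq_sqrt hx.le
    have hll : √lam ^ 2 = lam := Real.sq_sqrt hl.le
    have hp : 0 < √(2 * Real.pi) := by positivity
    have hg := igDensity_nonneg μ lam x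
    rw [abs_of_pos (by positivity), ← ENNReal.ofReal_mul (by positivity),
      ← ENNReal.ofReal_add hg (by positivity), ← ENNReal.ofReal_mul (by positivity)]
    congr 1
    rw [igDensity_of_pos _ _ hx, sqrt_two_pi_cube hx]
    have : -(1 / 2) * (√lam * (√x / μ - (√x)⁻¹)) ^ 2 =
        -(lam * (x - μ) ^ 2 / (2 * x * μ ^ 2)) := by
      rw [mul_pow, hll]
      field_simp
      rw [hss]
      ring
    rw [this]
    field_simp
    rw [hss]
    ring
  have h := lintegral_image_eq_lintegral_abs_deriv_mul (s := Set.Ioi (0 : ℝ)) measurableSet_Ioi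
    hder hinj fun u => ENNReal.ofReal (Real.exp (-(1 / 2) * u ^ 2))
  rw [himg, Measure.restrict_univ, hG, setLIntegral_congr_fun measurableSet_Ioi key,
    lintegral_const_mul _ (by
      have := measurable_igDensity_right μ lam
      fun_prop),
    lintegral_add_left (measurable_igDensity_right μ lam).ennreal_ofReal,
    lintegral_mul_igDensity hμ] at h
  set I := ∫⁻ x in Set.Ioi 0, ENNReal.ofReal (igDensity μ lam x)
  have hp : 0 < √(2 * Real.pi) := by positivity
  have e1 : ENNReal.ofReal (√(2 * Real.pi) / 2) * (I + I) = ENNReal.ofReal √(2 * Real.pi) * I := by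
    rw [← two_mul, ← mul_assoc, show (2 : ENNReal) = ENNReal.ofReal 2 by simp,
      ← ENNReal.ofReal_mul (by positivity)]
    congr 2; ring
  rw [e1] at h
  have h0 : ENNReal.ofReal √(2 * Real.pi) ≠ 0 := by simpa using hp
  have := congrArg (fun t => (ENNReal.ofReal √(2 * Real.pi))⁻¹ * t) h
  simp only [← mul_assoc, ENNReal.inv_mul_cancel h0 ENNReal.ofReal_ne_top, one_mul] at this
  exact this.symm

theorem isProbabilityMeasure_inverseGaussian {μ lam : ℝ} (hμ : 0 < μ) (hl : 0 < lam) :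
    IsProbabilityMeasure (inverseGaussian μ lam) := by
  constructor
  rw [← lintegral_one, lintegral_inverseGaussian _ _ measurable_const]
  simpa using lintegral_igDensity hμ hl

theorem ae_pos_inverseGaussian (μ lam : ℝ) : ∀ᵐ x ∂inverseGaussian μ lam, 0 < x := by
  have h : inverseGaussian μ lam (Set.Ioi 0)ᶜ = 0 := by
    rw [← lintegral_indicator_one measurableSet_Ioi.compl,
      lintegral_inverseGaussian _ _ (measurable_one.indicator measurableSet_Ioi.compl)]
    refine (setLIntegral_congr_fun (g := fun _ => 0) measurableSet_Ioi fun x hx => ?_).trans (by simp)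
    simp only [Set.mem_Ioi] at hx
    simp [hx]
  exact h

theorem inverseGaussian_pos_of_subset {μ lam a b : ℝ} (hl : 0 < lam) (ha : 0 ≤ a) (hab : a < b)
    {B : Set ℝ} (hB : Set.Ioo a b ⊆ B) : 0 < inverseGaussian μ lam B := by
  refine lt_of_lt_of_le ?_ (measure_mono hB)
  rw [pos_iff_ne_zero, inverseGaussian_eq, withDensity_apply _ measurableSet_Ioo, Ne,
    setLIntegral_eq_zero_iff measurableSet_Ioo (measurable_igDensity_right μ lam).ennreal_ofReal]
  intro h
  have h2 : ∀ᵐ x : ℝ, x ∉ Set.Ioo a b := by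
    filter_upwards [h] with x hx hxm
    have := hx hxm
    rw [ENNReal.ofReal_eq_zero] at this
    exact absurd (igDensity_pos (μ := μ) hl (ha.trans_lt hxm.1)) (not_lt.2 this)
  have h3 : volume (Set.Ioo a b) = 0 := by
    rw [← ae_iff.1 h2]
    congr 1
    ext x
    simp
  rw [Real.volume_Ioo] at h3
  simp at h3
  linarith

theorem lintegral_Ioi_scale {c : ℝ} (hc : 0 < c) (φ : ℝ → ENNReal) :
    ∫⁻ x in Set.Ioi 0, φ x = ∫⁻ y in Set.Ioi 0, ENNReal.ofReal c * φ (c * y) := by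
  have himg : (fun y : ℝ => c * y) '' Set.Ioi 0 = Set.Ioi 0 := by
    rw [Set.image_mul_left_Ioi hc, mul_zero]
  have hder : ∀ y ∈ Set.Ioi (0 : ℝ), HasDerivWithinAt (fun y : ℝ => c * y) c (Set.Ioi 0) y :=
    fun y _ => by simpa using ((hasDerivAt_id y).const_mul c).hasDerivWithinAt
  have h := lintegral_image_eq_lintegral_abs_deriv_mul measurableSet_Ioi hder
    (mul_right_injective₀ hc.ne').injOn φ
  rwa [himg, abs_of_pos hc] at h

/-- The Laplace transform of `(x, 1/x)` under `IG(1, m)`. -/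
theorem lintegral_exp_inverseGaussian {m s t : ℝ} (hm : 0 < m) (hs : 0 ≤ s) (ht : 0 ≤ t) :
    ∫⁻ x, ENNReal.ofReal (Real.exp (-(m / 2 * (s * x + t / x)))) ∂inverseGaussian 1 m =
      ENNReal.ofReal (1 / √(1 + t) * Real.exp (-(m * (√((1 + t) * (1 + s)) - 1)))) := by
  have h1 : 0 < 1 + t := by positivity
  have h2 : 0 < 1 + s := by positivity
  set a := √(1 + t) with ha
  set b := √(1 + s) with hb
  have ha0 : 0 < a := Real.sqrt_pos.2 h1
  have hb0 : 0 < b := Real.sqrt_pos.2 h2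
  have haa : a ^ 2 = 1 + t := Real.sq_sqrt h1.le
  have hbb : b ^ 2 = 1 + s := Real.sq_sqrt h2.le
  rw [lintegral_inverseGaussian _ _ (by fun_prop), Real.sqrt_mul h1.le, ← ha, ← hb]
  -- Exponential tilting stays in the family: with `a = √(1+t)` and `b = √(1+s)`, the tilted density
  -- is a constant times that of `IG(a/b, m a²)`, whose mass is one.
  have key : ∀ x ∈ Set.Ioi (0 : ℝ), ENNReal.ofReal (igDensity 1 m x) *
      ENNReal.ofReal (Real.exp (-(m / 2 * (s * x + t / x)))) =
      ENNReal.ofReal (1 / a * Real.exp (-(m * (a * b - 1)))) *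
        ENNReal.ofReal (igDensity (a / b) (m * a ^ 2) x) := by
    intro x hx
    simp only [Set.mem_Ioi] at hx
    rw [← ENNReal.ofReal_mul (igDensity_nonneg _ _ _), ← ENNReal.ofReal_mul (by positivity)]
    congr 1
    rw [igDensity_of_pos _ _ hx, igDensity_of_pos _ _ hx, Real.sqrt_mul hm.le, Real.sqrt_sq ha0.le]
    have e : Real.exp (-(m * (x - 1) ^ 2 / (2 * x * 1 ^ 2))) *
        Real.exp (-(m / 2 * (s * x + t / x))) = Real.exp (-(m * (a * b - 1))) *
        Real.exp (-(m * a ^ 2 * (x - a / b) ^ 2 / (2 * x * (a / b) ^ 2))) := by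
      rw [← Real.exp_add, ← Real.exp_add]
      congr 1
      have hs' : s = b ^ 2 - 1 := by linarith
      have ht' : t = a ^ 2 - 1 := by linarith
      rw [hs', ht']
      field_simp
      ring
    rw [mul_assoc, e]
    field_simp
  rw [setLIntegral_congr_fun measurableSet_Ioi key,
    lintegral_const_mul _ (measurable_igDensity_right _ _).ennreal_ofReal,
    lintegral_igDensity (by positivity) (by positivity), mul_one]

/-! ### The exchange identity. -/

/-- The change of variables `p = q/x`, `x = (m + q/z) y` at the level of densities: the factors `m +
q/z` and `x⁻¹` on the left are its Jacobians. In these variables `z/x + p/m = z/(m y)` and `p x =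
q`. -/
theorem igDensity_mul_igDensity {z m q y : ℝ} (hz : 0 < z) (hm : 0 < m) (hq : 0 < q) (hy : 0 < y) :
    (m + q / z) * (((m + q / z) * y)⁻¹ * (igDensity 1 (1 / z) (((m + q / z) * y)⁻¹ * q) *
      igDensity 1 m ((m + q / z) * y))) =
      igDensity (1 / (m + 1 / z)) 1 y * igDensity 1 (1 / (z / m * (1 / y))) q := by
  have hc : 0 < m + q / z := by positivity
  have hx : 0 < (m + q / z) * y := by positivity
  have hp : 0 < ((m + q / z) * y)⁻¹ * q := by positivity
  rw [igDensity_of_pos _ _ hx, igDensity_of_pos _ _ hp, igDensity_of_pos _ _ hq,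
    igDensity_of_pos _ _ hy]
  have e : Real.exp (-(1 / z * (((m + q / z) * y)⁻¹ * q - 1) ^ 2 /
        (2 * (((m + q / z) * y)⁻¹ * q) * 1 ^ 2))) *
      Real.exp (-(m * ((m + q / z) * y - 1) ^ 2 / (2 * ((m + q / z) * y) * 1 ^ 2))) =
      Real.exp (-(1 * (y - 1 / (m + 1 / z)) ^ 2 / (2 * y * (1 / (m + 1 / z)) ^ 2))) *
      Real.exp (-(1 / (z / m * (1 / y)) * (q - 1) ^ 2 / (2 * q * 1 ^ 2))) := by
    rw [← Real.exp_add, ← Real.exp_add]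
    congr 1
    have : m * z + q ≠ 0 := by positivity
    have : m * z + 1 ≠ 0 := by positivity
    field_simp
    ring
  have e2 : √(1 / z) / √(2 * Real.pi * (((m + q / z) * y)⁻¹ * q) ^ 3) *
      (√m / √(2 * Real.pi * ((m + q / z) * y) ^ 3)) * y⁻¹ =
      √1 / √(2 * Real.pi * y ^ 3) * (√(1 / (z / m * (1 / y))) / √(2 * Real.pi * q ^ 3)) := by
    -- Everything, including `y⁻¹` written as `√(y⁻¹ ^ 2)`, is gathered under one square root, so
    -- that only a rational identity remains.
    rw [← Real.sqrt_div' _ (by positivity), ← Real.sqrt_div' _ (by positivity),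
      ← Real.sqrt_div' _ (by positivity), ← Real.sqrt_div' _ (by positivity),
      ← Real.sqrt_mul (by positivity), ← Real.sqrt_mul (by positivity),
      ← Real.sqrt_sq (inv_nonneg.2 hy.le), ← Real.sqrt_mul (by positivity)]
    congr 1
    have : m * z + q ≠ 0 := by positivity
    field_simp
  calc _ = (√(1 / z) / √(2 * Real.pi * (((m + q / z) * y)⁻¹ * q) ^ 3) *
      (√m / √(2 * Real.pi * ((m + q / z) * y) ^ 3)) * y⁻¹) *
      (Real.exp (-(1 / z * (((m + q / z) * y)⁻¹ * q - 1) ^ 2 /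
        (2 * (((m + q / z) * y)⁻¹ * q) * 1 ^ 2))) *
      Real.exp (-(m * ((m + q / z) * y - 1) ^ 2 / (2 * ((m + q / z) * y) * 1 ^ 2)))) := by
        generalize Real.exp _ = A
        generalize Real.exp _ = B
        generalize √(1 / z) / √(2 * Real.pi * (((m + q / z) * y)⁻¹ * q) ^ 3) = C
        generalize √m / √(2 * Real.pi * ((m + q / z) * y) ^ 3) = D
        generalize m + q / z = c at hc
        field_simp
    _ = _ := by
        rw [e, e2]
        ring

/-- If `p ~ IG(1, 1/z)` and `x ~ IG(1, m)` are independent, then `z/x + p/m` is distributed as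
`z/(m y)` with `y ~ IG(1/(m + 1/z), 1)`, and given `w = z/x + p/m` the product `p x` has law
`IG(1, 1/w)`. -/
theorem lintegral_inverseGaussian_exchange {z m : ℝ} (hz : 0 < z) (hm : 0 < m)
    {F : ℝ → ℝ → ENNReal} (hF : Measurable fun q : ℝ × ℝ => F q.1 q.2) :
    ∫⁻ p, ∫⁻ x, F (z / x + p / m) (p * x) ∂inverseGaussian 1 m ∂inverseGaussian 1 (1 / z) =
      ∫⁻ y, ∫⁻ p, F (z / m * (1 / y)) p ∂inverseGaussian 1 (1 / (z / m * (1 / y)))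
        ∂inverseGaussian (1 / (m + 1 / z)) 1 := by
  have hF' : ∀ {α : Type} [MeasurableSpace α] {u v : α → ℝ}, Measurable u → Measurable v →
      Measurable fun a => F (u a) (v a) := fun hu hv => hF.comp (hu.prodMk hv)
  have hI : ∀ {α : Type} [MeasurableSpace α] {u v w : α → ℝ}, Measurable u → Measurable v →
      Measurable w → Measurable fun a => ENNReal.ofReal (igDensity (u a) (v a) (w a)) :=
    fun hu hv hw => (measurable_igDensity.comp (hu.prodMk (hv.prodMk hw))).ennreal_ofReal
  have hL : ∀ p : ℝ, ∫⁻ x, F (z / x + p / m) (p * x) ∂inverseGaussian 1 m =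
      ∫⁻ x in Set.Ioi 0, ENNReal.ofReal (igDensity 1 m x) * F (z / x + p / m) (p * x) :=
    fun p => lintegral_inverseGaussian _ _ (hF' (by fun_prop) (by fun_prop))
  have hR : ∀ y : ℝ, ∫⁻ p, F (z / m * (1 / y)) p ∂inverseGaussian 1 (1 / (z / m * (1 / y))) =
      ∫⁻ p in Set.Ioi 0, ENNReal.ofReal (igDensity 1 (1 / (z / m * (1 / y))) p) *
        F (z / m * (1 / y)) p :=
    fun y => lintegral_inverseGaussian _ _ (hF' (by fun_prop) (by fun_prop))
  have mL : Measurable fun q : ℝ × ℝ => ENNReal.ofReal (igDensity 1 m q.2) *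
      F (z / q.2 + q.1 / m) (q.1 * q.2) :=
    (hI (by fun_prop) (by fun_prop) (by fun_prop)).mul (hF' (by fun_prop) (by fun_prop))
  have mR : Measurable fun q : ℝ × ℝ => ENNReal.ofReal (igDensity 1 (1 / (z / m * (1 / q.1))) q.2) *
      F (z / m * (1 / q.1)) q.2 :=
    (hI (by fun_prop) (by fun_prop) (by fun_prop)).mul (hF' (by fun_prop) (by fun_prop))
  simp_rw [hL, hR]
  rw [lintegral_inverseGaussian _ _ (mL.lintegral_prod_right'),
    lintegral_inverseGaussian _ _ (mR.lintegral_prod_right')]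
  have e1 : ∀ p : ℝ, ENNReal.ofReal (igDensity 1 (1 / z) p) *
      (∫⁻ x in Set.Ioi 0, ENNReal.ofReal (igDensity 1 m x) * F (z / x + p / m) (p * x)) =
      ∫⁻ x in Set.Ioi 0, ENNReal.ofReal (igDensity 1 (1 / z) p) *
        (ENNReal.ofReal (igDensity 1 m x) * F (z / x + p / m) (p * x)) := fun p =>
    (lintegral_const_mul _ (mL.comp (by fun_prop : Measurable fun x : ℝ => (p, x)))).symm
  have e2 : ∀ y : ℝ, ENNReal.ofReal (igDensity (1 / (m + 1 / z)) 1 y) *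
      (∫⁻ p in Set.Ioi 0, ENNReal.ofReal (igDensity 1 (1 / (z / m * (1 / y))) p) *
        F (z / m * (1 / y)) p) =
      ∫⁻ p in Set.Ioi 0, ENNReal.ofReal (igDensity (1 / (m + 1 / z)) 1 y) *
        (ENNReal.ofReal (igDensity 1 (1 / (z / m * (1 / y))) p) * F (z / m * (1 / y)) p) := fun y =>
    (lintegral_const_mul _ (mR.comp (by fun_prop : Measurable fun x : ℝ => (y, x)))).symm
  simp_rw [e1, e2]
  rw [lintegral_lintegral_swap (((hI (by fun_prop) (by fun_prop) (by fun_prop)).mul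
      ((hI (by fun_prop) (by fun_prop) (by fun_prop)).mul
        (hF' (by fun_prop) (by fun_prop))) :
        Measurable fun q : ℝ × ℝ => ENNReal.ofReal (igDensity 1 (1 / z) q.1) *
        (ENNReal.ofReal (igDensity 1 m q.2) * F (z / q.2 + q.1 / m) (q.1 * q.2))).aemeasurable)]
  conv_rhs => rw [lintegral_lintegral_swap (((hI (by fun_prop) (by fun_prop) (by fun_prop)).mul
      ((hI (by fun_prop) (by fun_prop) (by fun_prop)).mul
        (hF' (by fun_prop) (by fun_prop))) :
        Measurable fun q : ℝ × ℝ => ENNReal.ofReal (igDensity (1 / (m + 1 / z)) 1 q.1) *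
        (ENNReal.ofReal (igDensity 1 (1 / (z / m * (1 / q.1))) q.2) *
          F (z / m * (1 / q.1)) q.2)).aemeasurable)]
  -- Substitution `p = q/x` at fixed `x`; after another swap, `x` is rescaled by `m + q/z` at fixed
  -- `q`.
  have e3 : ∀ x ∈ Set.Ioi (0 : ℝ), (∫⁻ p in Set.Ioi 0, ENNReal.ofReal (igDensity 1 (1 / z) p) *
        (ENNReal.ofReal (igDensity 1 m x) * F (z / x + p / m) (p * x))) =
      ∫⁻ q in Set.Ioi 0, ENNReal.ofReal x⁻¹ * (ENNReal.ofReal (igDensity 1 (1 / z) (x⁻¹ * q)) *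
        (ENNReal.ofReal (igDensity 1 m x) * F (z / x + (x⁻¹ * q) / m) (x⁻¹ * q * x))) :=
    fun x hx => lintegral_Ioi_scale (inv_pos.2 hx) _
  rw [setLIntegral_congr_fun measurableSet_Ioi e3]
  rw [lintegral_lintegral_swap (((by fun_prop : Measurable fun q : ℝ × ℝ =>
      ENNReal.ofReal q.1⁻¹).mul ((hI (by fun_prop) (by fun_prop) (by fun_prop)).mul
      ((hI (by fun_prop) (by fun_prop) (by fun_prop)).mul
        (hF' (by fun_prop) (by fun_prop)))) :
        Measurable fun q : ℝ × ℝ => ENNReal.ofReal q.1⁻¹ *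
        (ENNReal.ofReal (igDensity 1 (1 / z) (q.1⁻¹ * q.2)) *
        (ENNReal.ofReal (igDensity 1 m q.1) *
          F (z / q.1 + (q.1⁻¹ * q.2) / m) (q.1⁻¹ * q.2 * q.1)))).aemeasurable)]
  refine setLIntegral_congr_fun measurableSet_Ioi fun q hq => ?_
  simp only [Set.mem_Ioi] at hq
  have hc : 0 < m + q / z := by positivity
  rw [lintegral_Ioi_scale hc]
  refine setLIntegral_congr_fun measurableSet_Ioi fun y hy => ?_
  simp only [Set.mem_Ioi] at hy
  have a1 : z / ((m + q / z) * y) + ((m + q / z) * y)⁻¹ * q / m = z / m * (1 / y) := by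
    have : m * z + q ≠ 0 := by positivity
    field_simp
  have a2 : ((m + q / z) * y)⁻¹ * q * ((m + q / z) * y) = q := by field_simp
  simp only [a1, a2]
  have h := congrArg ENNReal.ofReal (igDensity_mul_igDensity hz hm hq hy)
  rw [ENNReal.ofReal_mul hc.le, ENNReal.ofReal_mul (by positivity),
    ENNReal.ofReal_mul (igDensity_nonneg _ _ _), ENNReal.ofReal_mul (igDensity_nonneg _ _ _)] at h
  rw [← mul_assoc (ENNReal.ofReal (igDensity (1 / (m + 1 / z)) 1 y)), ← h]
  ring

/-! ### Uniqueness of Laplace transforms on nonnegative sequences. -/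

/-- Two probability measures on `ℝ^ℕ` that charge only nonnegative sequences and have the same
Laplace transforms coincide. -/
theorem ext_of_forall_integral_exp_neg {μ ν : Measure (ℕ → ℝ)} [IsProbabilityMeasure μ]
    [IsProbabilityMeasure ν] (hμ : ∀ k, ∀ᵐ b ∂μ, 0 ≤ b k) (hν : ∀ k, ∀ᵐ b ∂ν, 0 ≤ b k)
    (h : ∀ (n : ℕ) (t : ℕ → ℝ), (∀ k, 0 ≤ t k) → (∀ k, n ≤ k → t k = 0) →
      ∫ b, Real.exp (-∑ k ∈ Finset.range n, t k * b k) ∂μ =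
        ∫ b, Real.exp (-∑ k ∈ Finset.range n, t k * b k) ∂ν) : μ = ν := by
  -- The coordinates `e^{-b_k}` move the problem to the compact space `[0,1]^ℕ`, where the
  -- polynomials in finitely many coordinates form a separating algebra. A monomial in them is a
  -- Laplace integrand with integer parameters, so its integral is known.
  let e : (ℕ → ℝ) → ℕ → Set.Icc (0 : ℝ) 1 := fun b k =>
    Set.projIcc 0 1 zero_le_one (Real.exp (-b k))
  let r : (ℕ → Set.Icc (0 : ℝ) 1) → ℕ → ℝ := fun y k => -Real.log (y k)
  have me : Measurable e := measurable_pi_lambda _ fun k =>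
    continuous_projIcc.measurable.comp (by fun_prop)
  have mr : Measurable r := by fun_prop
  have coe_e : ∀ b : ℕ → ℝ, (∀ k, 0 ≤ b k) → ∀ k, (e b k : ℝ) = Real.exp (-b k) := by
    intro b hb k
    have : Real.exp (-b k) ∈ Set.Icc (0 : ℝ) 1 :=
      ⟨(Real.exp_pos _).le, Real.exp_le_one_iff.2 (by simpa using hb k)⟩
    simp only [e]
    rw [Set.projIcc_of_mem _ this]
  have hre : ∀ b : ℕ → ℝ, (∀ k, 0 ≤ b k) → r (e b) = b := by
    intro b hb
    ext k
    simp only [r]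
    rw [coe_e b hb k, Real.log_exp, neg_neg]
  have hmap : ∀ ρ : Measure (ℕ → ℝ), (∀ k, ∀ᵐ b ∂ρ, 0 ≤ b k) → (ρ.map e).map r = ρ := by
    intro ρ hρ
    rw [Measure.map_map mr me]
    conv_rhs => rw [← Measure.map_id (μ := ρ)]
    refine Measure.map_congr ?_
    filter_upwards [ae_all_iff.2 hρ] with b hb using hre b hb
  let c : ℕ → BoundedContinuousFunction (ℕ → Set.Icc (0 : ℝ) 1) ℝ := fun k =>
    BoundedContinuousFunction.mkOfCompact ⟨fun y => (y k : ℝ), by fun_prop⟩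
  let A : StarSubalgebra ℝ (BoundedContinuousFunction (ℕ → Set.Icc (0 : ℝ) 1) ℝ) :=
    { (MvPolynomial.aeval c : MvPolynomial ℕ ℝ →ₐ[ℝ] _).range with
      star_mem' := fun {a} ha => by
        have : star a = a := by ext; simp
        rwa [this] }
  have hA : (A.map (BoundedContinuousFunction.toContinuousMapStarₐ ℝ)).SeparatesPoints := by
    intro x y hxy
    obtain ⟨k, hk⟩ := Function.ne_iff.1 hxy
    refine ⟨_, ⟨_, ⟨c k, ⟨MvPolynomial.X k, by simp⟩, rfl⟩, rfl⟩, ?_⟩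
    simpa [c] using fun h => hk (Subtype.ext h)
  have hcoe : ∀ (d : ℕ →₀ ℕ) (a : ℝ) (y : ℕ → Set.Icc (0 : ℝ) 1),
      MvPolynomial.aeval c (MvPolynomial.monomial d a) y = a * d.prod fun k j => (y k : ℝ) ^ j := by
    intro d a y
    rw [MvPolynomial.aeval_monomial]
    simp [Finsupp.prod, c, BoundedContinuousFunction.coe_prod]
  have hmono : ∀ (ρ : Measure (ℕ → ℝ)), (∀ k, ∀ᵐ b ∂ρ, 0 ≤ b k) → ∀ (d : ℕ →₀ ℕ) (a : ℝ),
      ∫ y, MvPolynomial.aeval c (MvPolynomial.monomial d a) y ∂(ρ.map e) =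
        a * ∫ b, Real.exp (-∑ k ∈ Finset.range (d.support.sup id + 1), (d k : ℝ) * b k) ∂ρ := by
    intro ρ hρ d a
    simp_rw [hcoe]
    rw [integral_const_mul, integral_map me.aemeasurable
      (by
        refine Measurable.aestronglyMeasurable ?_
        unfold Finsupp.prod
        fun_prop)]
    congr 1
    refine integral_congr_ae ?_
    filter_upwards [ae_all_iff.2 hρ] with b hb
    simp only [coe_e b hb]
    rw [Finsupp.prod, ← Finset.sum_neg_distrib, Real.exp_sum]
    refine Finset.prod_subset_one_on_sdiff ?_ ?_ ?_
    · intro k hk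
      exact Finset.mem_range.2 (Nat.lt_succ_of_le (Finset.le_sup (f := id) hk))
    · intro k hk
      have : d k = 0 := by simpa using (Finset.mem_sdiff.1 hk).2
      simp [this]
    · intro k _
      rw [← Real.exp_nat_mul]
      ring_nf
  have key : μ.map e = ν.map e := by
    have := Measure.isProbabilityMeasure_map (μ := μ) me.aemeasurable
    have := Measure.isProbabilityMeasure_map (μ := ν) me.aemeasurable
    refine ext_of_forall_mem_subalgebra_integral_eq_of_polish (𝕜 := ℝ) hA ?_
    rintro g ⟨p, rfl⟩
    simp only [AlgHom.toRingHom_eq_coe, RingHom.coe_coe]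
    induction p using MvPolynomial.induction_on' with
    | monomial d a =>
      rw [hmono μ hμ, hmono ν hν, h _ (fun k => (d k : ℝ)) (fun k => Nat.cast_nonneg _)]
      intro k hk
      by_contra hne
      have : k ∈ d.support := by simpa using hne
      have := Finset.le_sup (f := id) this
      simp only [id] at this
      omega
    | add p q hp hq =>
      simp only [map_add, BoundedContinuousFunction.coe_add, Pi.add_apply]
      rw [integral_add (BoundedContinuousFunction.integrable _ _)
        (BoundedContinuousFunction.integrable _ _), hp, hq,
        integral_add (BoundedContinuousFunction.integrable _ _)
        (BoundedContinuousFunction.integrable _ _)]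
  rw [← hmap μ hμ, key, hmap ν hν]

/-! ### Pivot ratios and the law of the potential. -/

/-- The pivots of the Gaussian elimination of the tridiagonal operator with diagonal `2 b` and
off-diagonal entries `-m`. -/
noncomputable def pivot (m : ℝ) (b : ℕ → ℝ) : ℕ → ℝ
  | 0 => 2 * b 0
  | k + 1 => 2 * b (k + 1) - m ^ 2 / pivot m b k

/-- The ratios `m / d_k`, where the `d_k` are the pivots. -/
noncomputable def pivotRatio (m : ℝ) (b : ℕ → ℝ) (k : ℕ) : ℝ := m / pivot m b k

/-- The sequence `x` shifted by one, with first entry `0`. -/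
def shiftSeq (x : ℕ → ℝ) : ℕ → ℝ
  | 0 => 0
  | k + 1 => x k

/-- The potential whose pivot ratios are `x`. -/
noncomputable def potentialOfRatios (m : ℝ) (x : ℕ → ℝ) (k : ℕ) : ℝ :=
  (m / x k + m * shiftSeq x k) / 2

theorem measurable_pivot (m : ℝ) (k : ℕ) : Measurable fun b => pivot m b k := by
  induction k with
  | zero => simp only [pivot]; fun_prop
  | succ k ih => simp only [pivot]; fun_prop

theorem measurable_pivotRatio (m : ℝ) : Measurable (pivotRatio m) :=
  measurable_pi_lambda _ fun k => (measurable_pivot m k).const_div m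

theorem measurable_shiftSeq : Measurable shiftSeq := by
  refine measurable_pi_lambda _ fun k => ?_
  cases k with
  | zero => exact measurable_const
  | succ k => exact measurable_pi_apply k

theorem measurable_potentialOfRatios (m : ℝ) : Measurable (potentialOfRatios m) := by
  refine measurable_pi_lambda _ fun k => ?_
  have := (measurable_pi_apply k).comp measurable_shiftSeq
  unfold potentialOfRatios
  simp only [Function.comp_def] at this
  fun_prop

theorem pivot_potentialOfRatios {m : ℝ} (hm : 0 < m) {x : ℕ → ℝ} (hx : ∀ k, 0 < x k) (k : ℕ) :
    pivot m (potentialOfRatios m x) k = m / x k := by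
  induction k with
  | zero => simp [pivot, potentialOfRatios, shiftSeq]; ring
  | succ k ih =>
    have := (hx k).ne'
    have := (hx (k + 1)).ne'
    rw [pivot, ih, potentialOfRatios, shiftSeq]
    field_simp
    ring

theorem pivotRatio_potentialOfRatios {m : ℝ} (hm : 0 < m) {x : ℕ → ℝ} (hx : ∀ k, 0 < x k) :
    pivotRatio m (potentialOfRatios m x) = x := by
  ext k
  have := (hx k).ne'
  rw [pivotRatio, pivot_potentialOfRatios hm hx]
  field_simp

theorem ae_pos_infinitePi_inverseGaussian {m : ℝ} (hm : 0 < m) :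
    ∀ᵐ x ∂Measure.infinitePi fun _ : ℕ => inverseGaussian 1 m, ∀ k, 0 < x k := by
  have := isProbabilityMeasure_inverseGaussian one_pos hm
  rw [ae_all_iff]
  intro k
  have h := Measure.infinitePi_map_eval (fun _ : ℕ => inverseGaussian 1 m) k
  have h2 := ae_pos_inverseGaussian 1 m
  rw [← h] at h2
  exact ae_of_ae_map (measurable_pi_apply k).aemeasurable h2

/-- Regrouping by `x_k`: it enters the potential at `k` through `1/x_k` and at `k + 1` through
`x_k`. The condition `t n = 0` makes the regrouping exact at the right end. -/
theorem sum_mul_potentialOfRatios (m : ℝ) (x t : ℕ → ℝ) (n : ℕ) (ht : t n = 0) :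
    ∑ k ∈ Finset.range n, t k * potentialOfRatios m x k =
      ∑ k ∈ Finset.range n, m / 2 * (t (k + 1) * x k + t k / x k) := by
  have h : ∑ k ∈ Finset.range n, t k * shiftSeq x k = ∑ k ∈ Finset.range n, t (k + 1) * x k := by
    have h1 := Finset.sum_range_succ (fun k => t k * shiftSeq x k) n
    have h2 := Finset.sum_range_succ' (fun k => t k * shiftSeq x k) n
    rw [ht, zero_mul, add_zero] at h1
    rw [← h1, h2, shiftSeq, mul_zero, add_zero]
    rfl
  calc _ = ∑ k ∈ Finset.range n, m / 2 * (t k / x k) +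
        m / 2 * ∑ k ∈ Finset.range n, t k * shiftSeq x k := by
        rw [Finset.mul_sum, ← Finset.sum_add_distrib]
        refine Finset.sum_congr rfl fun k _ => ?_
        rw [potentialOfRatios]; ring
    _ = _ := by
        rw [h, Finset.mul_sum, ← Finset.sum_add_distrib]
        refine Finset.sum_congr rfl fun k _ => ?_
        ring

/-- After the regrouping each factor involves one `x_k` only, so independence splits the integral
into the transforms of `lintegral_exp_inverseGaussian`. -/
theorem integral_exp_potentialOfRatios {m : ℝ} (hm : 0 < m) (n : ℕ) {t : ℕ → ℝ}
    (ht : ∀ k, 0 ≤ t k) (htn : t n = 0) :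
    ∫ b, Real.exp (-∑ k ∈ Finset.range n, t k * b k)
        ∂((Measure.infinitePi fun _ : ℕ => inverseGaussian 1 m).map (potentialOfRatios m)) =
      ∏ k ∈ Finset.range n,
        (1 / √(1 + t k) * Real.exp (-(m * (√((1 + t k) * (1 + t (k + 1))) - 1)))) := by
  have := isProbabilityMeasure_inverseGaussian one_pos hm
  rw [integral_map (measurable_potentialOfRatios m).aemeasurable
    (Measurable.aestronglyMeasurable (by fun_prop)), integral_eq_lintegral_of_nonneg_ae (ae_of_all _ fun _ => (Real.exp_pos _).le)
    (Measurable.aestronglyMeasurable (by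
      have := measurable_potentialOfRatios m
      fun_prop))]
  simp_rw [sum_mul_potentialOfRatios m _ t n htn, ← Finset.sum_neg_distrib, Real.exp_sum,
    ENNReal.ofReal_prod_of_nonneg (fun _ _ => (Real.exp_pos _).le)]
  have hind := ProbabilityTheory.iIndepFun_infinitePi (P := fun _ : ℕ => inverseGaussian 1 m)
    (X := fun (k : ℕ) (x : ℝ) =>
      ENNReal.ofReal (Real.exp (-(m / 2 * (t (k + 1) * x + t k / x))))) (fun k => by fun_prop)
  rw [ProbabilityTheory.lintegral_prod_eq_prod_lintegral_of_indepFun _ _ hind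
    (fun k => by fun_prop), ENNReal.toReal_prod]
  refine Finset.prod_congr rfl fun k _ => ?_
  have h := lintegral_exp_inverseGaussian hm (ht (k + 1)) (ht k)
  rw [← Measure.infinitePi_map_eval (fun _ : ℕ => inverseGaussian 1 m) k,
    lintegral_map (by fun_prop) (measurable_pi_apply k)] at h
  rw [h, ENNReal.toReal_ofReal (by positivity)]

theorem lineWeight_succPNat (m : ℝ) (i j : ℕ) :
    lineWeight m i.succPNat j.succPNat = if j = i + 1 ∨ i = j + 1 then m else 0 := by
  simp only [lineWeight, ← PNat.coe_inj, PNat.add_coe, Nat.succPNat_coe, PNat.one_coe,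
    Nat.succ_eq_add_one, add_left_inj]

theorem mem_image_succPNat {n : ℕ} {j : ℕ+} :
    j ∈ (Finset.range n).map ⟨Nat.succPNat, Nat.succPNat_injective⟩ ↔ (j : ℕ) ≤ n := by
  simp only [Finset.mem_map, Finset.mem_range, Function.Embedding.coeFn_mk]
  constructor
  · rintro ⟨k, hk, rfl⟩; simpa using hk
  · intro h
    exact ⟨j.natPred, by have := j.pos; rw [PNat.natPred]; omega, PNat.succPNat_natPred j⟩

/-- The index `i` stands for the vertex `i + 1`; only the rightmost vertex `n` of the segment has a
neighbour outside. -/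
theorem tsum_lineWeight_boundary (m : ℝ) {n i : ℕ} (hi : i < n) :
    (∑' j, if j ∈ (Finset.range n).map ⟨Nat.succPNat, Nat.succPNat_injective⟩ then 0
      else lineWeight m i.succPNat j) = if i + 1 < n then 0 else m := by
  rw [tsum_eq_single (i + 1).succPNat]
  · simp only [mem_image_succPNat, lineWeight_succPNat, Nat.succPNat_coe]
    simp
  · intro j hj
    obtain ⟨k, rfl⟩ : ∃ k : ℕ, j = k.succPNat := ⟨j.natPred, (PNat.succPNat_natPred j).symm⟩
    simp only [mem_image_succPNat, lineWeight_succPNat, Nat.succPNat_coe]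
    have hk : k ≠ i + 1 := fun h => hj (by rw [h])
    split_ifs <;> first | rfl | omega

theorem sum_lineWeight (m : ℝ) (n : ℕ) {g : ℕ → ℕ → ℝ} (hg : ∀ i j, g i j = g j i) :
    1 / 2 * ∑ i ∈ Finset.range n, ∑ j ∈ Finset.range n,
      lineWeight m i.succPNat j.succPNat * g i j =
      ∑ i ∈ Finset.range n, if i + 1 < n then m * g i (i + 1) else 0 := by
  have h : ∀ i j, lineWeight m i.succPNat j.succPNat * g i j =
      (if j = i + 1 then m * g i j else 0) + if i = j + 1 then m * g j i else 0 := by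
    intro i j
    rw [lineWeight_succPNat]
    by_cases h1 : j = i + 1
    · have : ¬ i = j + 1 := by omega
      rw [if_pos (Or.inl h1), if_pos h1, if_neg this, add_zero]
    · by_cases h2 : i = j + 1
      · rw [if_pos (Or.inr h2), if_neg h1, if_pos h2, zero_add, hg i j]
      · simp [h1, h2]
  simp_rw [h, Finset.sum_add_distrib]
  rw [Finset.sum_comm (f := fun i j => if i = j + 1 then m * g j i else 0)]
  simp_rw [Finset.sum_ite_eq', Finset.mem_range]
  ring

/-- The boundary term at the last vertex is an edge term whose outer parameter is zero. Extending
`t` by `t n = 0` therefore gives every edge, inner or boundary, the same form. -/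
theorem IsBetaLaw.integral_exp_lineWeight {m : ℝ} {ν : Measure (ℕ+ → ℝ)}
    (h : IsBetaLaw (lineWeight m) ν) (n : ℕ) {t : ℕ → ℝ} (ht : ∀ k, 0 ≤ t k) (htn : t n = 0) :
    ∫ β, Real.exp (-∑ k ∈ Finset.range n, t k * β k.succPNat) ∂ν =
      ∏ k ∈ Finset.range n,
        (1 / √(1 + t k) * Real.exp (-(m * (√((1 + t k) * (1 + t (k + 1))) - 1)))) := by
  have hl := h.laplace ((Finset.range n).map ⟨Nat.succPNat, Nat.succPNat_injective⟩)
    (fun j => t j.natPred) (fun _ _ => ht _)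
  have hb : ∑ i ∈ Finset.range n, (∑' j, if j ∈ (Finset.range n).map
        ⟨Nat.succPNat, Nat.succPNat_injective⟩ then 0 else lineWeight m i.succPNat j) *
        (√(t i + 1) - 1) =
      ∑ i ∈ Finset.range n, (if i + 1 < n then 0 else m) * (√(t i + 1) - 1) :=
    Finset.sum_congr rfl fun i hi => by rw [tsum_lineWeight_boundary m (Finset.mem_range.1 hi)]
  have hs := sum_lineWeight m n (g := fun i j => √((t i + 1) * (t j + 1)) - 1)
    (fun i j => by simp only [mul_comm])
  simp only [Finset.sum_map, Finset.prod_map, Function.Embedding.coeFn_mk, Nat.natPred_succPNat]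
    at hl
  rw [hl, hb, hs, Finset.prod_mul_distrib, mul_comm, ← Real.exp_sum, ← neg_add',
    ← Finset.sum_add_distrib, Finset.sum_neg_distrib]
  congr 3
  refine Finset.sum_congr rfl fun i hi => ?_
  rw [add_comm (t i), add_comm (t (i + 1))]
  by_cases h1 : i + 1 < n
  · simp [h1]
  · have : i + 1 = n := by have := Finset.mem_range.1 hi; omega
    simp [this, htn]

/-- Under the law `ν^{K_m}` of the half-line, the pivot ratios are independent with common law
`IG(1, m)`. -/
theorem IsBetaLaw.map_pivotRatio {m : ℝ} (hm : 0 < m) {ν : Measure (ℕ+ → ℝ)}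
    (h : IsBetaLaw (lineWeight m) ν) :
    ν.map (fun β => pivotRatio m fun k => β k.succPNat) =
      Measure.infinitePi fun _ : ℕ => inverseGaussian 1 m := by
  have := isProbabilityMeasure_inverseGaussian one_pos hm
  have := h.isProbabilityMeasure
  have ms : Measurable fun (β : ℕ+ → ℝ) (k : ℕ) => β k.succPNat := by fun_prop
  have hp := ae_pos_infinitePi_inverseGaussian hm
  have key : ν.map (fun (β : ℕ+ → ℝ) (k : ℕ) => β k.succPNat) =
      (Measure.infinitePi fun _ : ℕ => inverseGaussian 1 m).map (potentialOfRatios m) := by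
    have := Measure.isProbabilityMeasure_map (μ := ν) ms.aemeasurable
    have := Measure.isProbabilityMeasure_map (measurable_potentialOfRatios m).aemeasurable
      (μ := Measure.infinitePi fun _ : ℕ => inverseGaussian 1 m)
    refine ext_of_forall_integral_exp_neg ?_ ?_ ?_
    · intro k
      rw [ae_map_iff ms.aemeasurable (measurableSet_le measurable_const (measurable_pi_apply k))]
      exact h.nonneg _
    · intro k
      rw [ae_map_iff (measurable_potentialOfRatios m).aemeasurable
        (measurableSet_le measurable_const (measurable_pi_apply k))]
      filter_upwards [hp] with x hx
      have h1 := hx k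
      have h2 : 0 ≤ shiftSeq x k := by
        cases k with
        | zero => exact le_rfl
        | succ k => exact (hx k).le
      unfold potentialOfRatios
      positivity
    · intro n t ht htn
      rw [integral_exp_potentialOfRatios hm n ht (htn n le_rfl),
        integral_map ms.aemeasurable (Measurable.aestronglyMeasurable (by fun_prop)),
        h.integral_exp_lineWeight n ht (htn n le_rfl)]
  calc _ = (ν.map (fun (β : ℕ+ → ℝ) (k : ℕ) => β k.succPNat)).map (pivotRatio m) :=
        (Measure.map_map (measurable_pivotRatio m) ms).symm
    _ = (Measure.infinitePi fun _ : ℕ => inverseGaussian 1 m).map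
        (pivotRatio m ∘ potentialOfRatios m) := by
        rw [key, Measure.map_map (measurable_pivotRatio m) (measurable_potentialOfRatios m)]
    -- The pivot ratios invert the potential only at positive sequences, which have full measure.
    _ = (Measure.infinitePi fun _ : ℕ => inverseGaussian 1 m).map id := by
        refine Measure.map_congr ?_
        filter_upwards [hp] with x hx using pivotRatio_potentialOfRatios hm hx
    _ = _ := Measure.map_id

/-! ### Quadratic form and positive definiteness of the restricted operators. -/

theorem sum_Icc_natPred (n : ℕ+) (f : ℕ → ℝ) :
    ∑ i : Set.Icc (1 : ℕ+) n, f i.1.natPred = ∑ k ∈ Finset.range n, f k := by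
  refine Finset.sum_bij' (fun i _ => i.1.natPred)
    (fun k hk => ⟨k.succPNat, one_le, ?_⟩) ?_ ?_ ?_ ?_ ?_
  · rw [← PNat.coe_le_coe]; simpa using Finset.mem_range.1 hk
  · intro i _
    have := PNat.coe_le_coe _ _ |>.2 i.2.2
    have := i.1.pos
    simp only [Finset.mem_range, PNat.natPred]
    omega
  · simp
  · intro i _; simp
  · intro k _; simp
  · simp

/-- With vertices numbered from `0`, the missing neighbours at both ends are encoded by zeros: `f n
= 0` on the right, `shiftSeq f 0 = 0` on the left. -/
theorem boxOperator_mulVec (m : ℝ) (β : ℕ+ → ℝ) (n : ℕ+) {f : ℕ → ℝ} (hf : f n = 0)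
    (i : Set.Icc (1 : ℕ+) n) :
    (boxOperator m β n).mulVec (fun j => f j.1.natPred) i =
      2 * β i * f i.1.natPred - m * f (i.1.natPred + 1) - m * shiftSeq f i.1.natPred := by
  obtain ⟨k, hk⟩ : ∃ k : ℕ, i.1 = k.succPNat := ⟨_, (PNat.succPNat_natPred i.1).symm⟩
  have hkn : k < n := by
    have := PNat.coe_le_coe _ _ |>.2 i.2.2
    rw [hk] at this
    simpa using this
  let F : ℕ → ℝ := fun l => (if l = k then 2 * β i * f l else 0) -
    (if l = k + 1 then m * f l else 0) - if l + 1 = k then m * f l else 0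
  have h : ∀ j : Set.Icc (1 : ℕ+) n, boxOperator m β n i j * f j.1.natPred = F j.1.natPred := by
    intro j
    obtain ⟨l, hl⟩ : ∃ l : ℕ, j.1 = l.succPNat := ⟨_, (PNat.succPNat_natPred j.1).symm⟩
    simp only [boxOperator, schrodinger, Matrix.submatrix_apply, Matrix.of_apply, hk, hl,
      Nat.natPred_succPNat, lineWeight_succPNat, Nat.succPNat_inj, F]
    by_cases h1 : l = k
    · subst h1; simp
    · by_cases h2 : l = k + 1
      · have : ¬ l + 1 = k := by omega
        have e1 : ¬ k = l := by omega
        rw [if_neg e1, if_pos (Or.inl h2), if_neg h1, if_pos h2, if_neg this]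
        ring
      · by_cases h3 : l + 1 = k
        · have e1 : ¬ k = l := by omega
          have e2 : k = l + 1 := h3.symm
          rw [if_neg e1, if_pos (Or.inr e2), if_neg h1, if_neg h2, if_pos h3]
          ring
        · have e1 : ¬ k = l := by omega
          have e2 : ¬ k = l + 1 := by omega
          simp [e1, e2, h1, h2, h3]
  rw [Matrix.mulVec, dotProduct, Finset.sum_congr rfl fun j _ => h j, sum_Icc_natPred n F,
    Finset.sum_sub_distrib, Finset.sum_sub_distrib, hk, Nat.natPred_succPNat,
    Finset.sum_ite_eq', Finset.sum_ite_eq', if_pos (Finset.mem_range.2 hkn)]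
  congr 2
  · by_cases h1 : k + 1 < n
    · simp [h1]
    · have : k + 1 = n := by omega
      simp [this, hf]
  · cases k with
    | zero => simp [shiftSeq]
    | succ k =>
      simp only [add_left_inj, Finset.sum_ite_eq', Finset.mem_range, shiftSeq]
      rw [if_pos (by omega)]

/-- Completing the squares one vertex at a time. The cross term `f n * f (n + 1)` left over by the
last row meets its mirror image from the next row and completes the square with pivot `n`. -/
theorem sum_tridiagonal_eq (m : ℝ) (b f : ℕ → ℝ) (n : ℕ) (hd : ∀ k < n, pivot m b k ≠ 0) :
    ∑ k ∈ Finset.range (n + 1), f k * (2 * b k * f k - m * f (k + 1) - m * shiftSeq f k) =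
      ∑ k ∈ Finset.range n, pivot m b k * (f k - pivotRatio m b k * f (k + 1)) ^ 2 +
        pivot m b n * f n ^ 2 - m * f n * f (n + 1) := by
  induction n with
  | zero => simp [pivot, shiftSeq]; ring
  | succ n ih =>
    rw [Finset.sum_range_succ, ih fun k hk => hd k (by omega), Finset.sum_range_succ _ n]
    have := hd n (by omega)
    simp only [pivot, pivotRatio, shiftSeq]
    field_simp
    ring

theorem isHermitian_boxOperator (m : ℝ) (β : ℕ+ → ℝ) (n : ℕ+) :
    (boxOperator m β n).IsHermitian := by
  ext i j
  simp only [boxOperator, schrodinger, Matrix.conjTranspose_apply, Matrix.submatrix_apply,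
    Matrix.of_apply, star_trivial, lineWeight]
  congr 1
  · by_cases h : i.1 = j.1
    · simp [h]
    · simp [h, Ne.symm h]
  · simp only [or_comm]

theorem dotProduct_boxOperator (m : ℝ) (β : ℕ+ → ℝ) (n : ℕ+) {f : ℕ → ℝ} (hf : f n = 0)
    (hd : ∀ k < n.natPred, pivot m (fun k => β k.succPNat) k ≠ 0) :
    (fun j : Set.Icc (1 : ℕ+) n => f j.1.natPred) ⬝ᵥ
      (boxOperator m β n).mulVec (fun j => f j.1.natPred) =
      ∑ k ∈ Finset.range n.natPred, pivot m (fun k => β k.succPNat) k *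
        (f k - pivotRatio m (fun k => β k.succPNat) k * f (k + 1)) ^ 2 +
        pivot m (fun k => β k.succPNat) n.natPred * f n.natPred ^ 2 := by
  have hn : (n : ℕ) = n.natPred + 1 := n.natPred_add_one.symm
  have h := sum_tridiagonal_eq m (fun k => β k.succPNat) f n.natPred hd
  rw [← hn, hf, mul_zero, sub_zero, ← sum_Icc_natPred] at h
  rw [← h, dotProduct]
  refine Finset.sum_congr rfl fun i _ => ?_
  rw [boxOperator_mulVec m β n hf, PNat.succPNat_natPred]

theorem posDef_boxOperator {m : ℝ} {β : ℕ+ → ℝ} {n : ℕ+}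
    (hd : ∀ k ≤ n.natPred, 0 < pivot m (fun k => β k.succPNat) k) :
    (boxOperator m β n).PosDef := by
  have hn : (n : ℕ) = n.natPred + 1 := n.natPred_add_one.symm
  refine Matrix.PosDef.of_dotProduct_mulVec_pos (isHermitian_boxOperator m β n) fun x hx => ?_
  let f : ℕ → ℝ := fun k => if h : k.succPNat ∈ Set.Icc 1 n then x ⟨k.succPNat, h⟩ else 0
  have hfn : f n = 0 := dif_neg fun h => by
    have := PNat.coe_le_coe _ _ |>.2 h.2
    simp at this
  have hfx : x = fun j => f j.1.natPred := by
    ext j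
    have : j.1 ∈ Set.Icc 1 n := j.2
    simp only [f, PNat.succPNat_natPred]
    rw [dif_pos this]
  have hs : star x = x := by ext; simp
  rw [hs, hfx, dotProduct_boxOperator m β n hfn fun k hk => (hd k hk.le).ne']
  set b := fun k : ℕ => β k.succPNat
  have hnn : ∀ k ∈ Finset.range n.natPred,
      0 ≤ pivot m b k * (f k - pivotRatio m b k * f (k + 1)) ^ 2 := fun k hk =>
    mul_nonneg (hd k (Finset.mem_range.1 hk).le).le (sq_nonneg _)
  have hlast : 0 ≤ pivot m b n.natPred * f n.natPred ^ 2 :=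
    mul_nonneg (hd _ le_rfl).le (sq_nonneg _)
  by_contra hneg
  have hsum := Finset.sum_nonneg hnn
  have h0 : ∑ k ∈ Finset.range n.natPred,
      pivot m b k * (f k - pivotRatio m b k * f (k + 1)) ^ 2 = 0 := by linarith
  have h1 : f n.natPred = 0 := by
    have : pivot m b n.natPred * f n.natPred ^ 2 = 0 := by linarith
    simpa [(hd _ le_rfl).ne'] using this
  -- If the form vanishes, so do all its squares; back substitution from the last vertex then kills
  -- the whole vector.
  have h2 : ∀ k < n.natPred, f k = pivotRatio m b k * f (k + 1) := by
    intro k hk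
    have := (Finset.sum_eq_zero_iff_of_nonneg hnn).1 h0 k (Finset.mem_range.2 hk)
    have := (mul_eq_zero.1 this).resolve_left (hd k hk.le).ne'
    exact sub_eq_zero.1 (pow_eq_zero_iff two_ne_zero |>.1 this)
  have h3 : ∀ j ≤ n.natPred, f (n.natPred - j) = 0 := by
    intro j
    induction j with
    | zero => intro _; simpa using h1
    | succ j ih =>
      intro hj
      rw [h2 _ (by omega), show n.natPred - (j + 1) + 1 = n.natPred - j by omega,
        ih (by omega), mul_zero]
  apply hx
  rw [hfx]
  ext j
  have hj : j.1.natPred ≤ n.natPred := by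
    have h4 := PNat.coe_le_coe _ _ |>.2 j.2.2
    have := j.1.natPred_add_one
    omega
  have := h3 (n.natPred - j.1.natPred) (by omega)
  rwa [show n.natPred - (n.natPred - j.1.natPred) = j.1.natPred by omega] at this

/-! ### Explicit formulas for the Green function, `ψ` and `Z`. -/

/-- The product of the first `n` terms of the sequence `x`. -/
def partialProd (x : ℕ → ℝ) (n : ℕ) : ℝ := ∏ k ∈ Finset.range n, x k

/-- The sum of the products of two successive partial products of `x`. -/
def partialProdSum (x : ℕ → ℝ) (n : ℕ) : ℝ :=
  ∑ k ∈ Finset.range n, partialProd x k * partialProd x (k + 1)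

theorem partialProd_succ (x : ℕ → ℝ) (n : ℕ) : partialProd x (n + 1) = partialProd x n * x n :=
  Finset.prod_range_succ _ _

theorem partialProdSum_succ (x : ℕ → ℝ) (n : ℕ) : partialProdSum x (n + 1) =
    partialProdSum x n + partialProd x n * partialProd x (n + 1) :=
  Finset.sum_range_succ _ _

theorem pivot_pos_of_posDef {m : ℝ} (hm : 0 < m) {β : ℕ+ → ℝ}
    (h : ∀ n, (boxOperator m β n).PosDef) (k : ℕ) : 0 < pivot m (fun k => β k.succPNat) k := by
  induction k using Nat.strong_induction_on with
  | _ k ih =>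
  set b := fun k : ℕ => β k.succPNat with hb
  have hpos : ∀ j ≤ k, 0 < partialProd (pivotRatio m b) j := fun j hj =>
    Finset.prod_pos fun l hl => div_pos hm (ih l (by have := Finset.mem_range.1 hl; omega))
  -- This test vector satisfies `f l = x_l f (l + 1)` for `l < k`, so all squares vanish and the
  -- form reduces to `d_k f_k²`.
  let f : ℕ → ℝ := fun j => if j ≤ k then (partialProd (pivotRatio m b) j)⁻¹ else 0
  have hfn : f k.succPNat = 0 := if_neg (by simp)
  have hne : (fun j : Set.Icc (1 : ℕ+) k.succPNat => f j.1.natPred) ≠ 0 := by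
    intro h0
    have := congrFun h0 ⟨k.succPNat, one_le, le_rfl⟩
    simp [f] at this
    exact (hpos k le_rfl).ne' this
  have hq := (h k.succPNat).dotProduct_mulVec_pos hne
  have hs : star (fun j : Set.Icc (1 : ℕ+) k.succPNat => f j.1.natPred) =
      fun j => f j.1.natPred := by ext; simp
  rw [hs, dotProduct_boxOperator m β _ hfn (by
    intro l hl
    rw [Nat.natPred_succPNat] at hl
    exact (ih l hl).ne'), Nat.natPred_succPNat, Finset.sum_eq_zero, zero_add] at hq
  · exact pos_of_mul_pos_left hq (sq_nonneg _)
  · intro l hl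
    have hl := Finset.mem_range.1 hl
    have h1 : f l = (partialProd (pivotRatio m b) l)⁻¹ := if_pos hl.le
    have h2 : f (l + 1) = (partialProd (pivotRatio m b) (l + 1))⁻¹ := if_pos hl
    have h3 := (hpos l hl.le).ne'
    have h4 : pivotRatio m b l ≠ 0 := (div_pos hm (ih l hl)).ne'
    rw [← hb, h1, h2, partialProd_succ]
    have : (partialProd (pivotRatio m b) l)⁻¹ - pivotRatio m b l *
        (partialProd (pivotRatio m b) l * pivotRatio m b l)⁻¹ = 0 := by
      field_simp
      ring
    rw [this]
    ring

theorem posDef_boxOperator_iff {m : ℝ} (hm : 0 < m) {β : ℕ+ → ℝ} :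
    (∀ n, (boxOperator m β n).PosDef) ↔ ∀ k, 0 < pivotRatio m (fun k => β k.succPNat) k := by
  constructor
  · intro h k
    exact div_pos hm (pivot_pos_of_posDef hm h k)
  · intro h n
    exact posDef_boxOperator fun k _ => (div_pos_iff_of_pos_left hm).1 (h k)

/-- The right-hand side, viewed as a vector vanishing at `n`, is checked to solve `H f = δ_1`. Both
the operator (`2 b k = m / x k + m x (k-1)`) and the vector (`hrec`) satisfy first-order relations
in the ratios, and these telescope. -/
theorem greenHat_one {m : ℝ} (hm : 0 < m) {β : ℕ+ → ℝ} {n : ℕ+} (h : ∀ n, (boxOperator m β n).PosDef)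
    (i : Set.Icc (1 : ℕ+) n) :
    greenHat m β n i ⟨1, le_refl 1, one_le⟩ =
      (partialProdSum (pivotRatio m fun k => β k.succPNat) n -
        partialProdSum (pivotRatio m fun k => β k.succPNat) i.1.natPred) /
      (m * partialProd (pivotRatio m fun k => β k.succPNat) i.1.natPred) := by
  have hx := (posDef_boxOperator_iff hm).1 h
  set b := fun k : ℕ => β k.succPNat with hb
  set x := pivotRatio m b with hxdef
  have hP : ∀ k, partialProd x k ≠ 0 := fun k => (Finset.prod_pos fun l _ => hx l).ne'
  let f : ℕ → ℝ := fun k => (partialProdSum x n - partialProdSum x k) / (m * partialProd x k)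
  have hfn : f n = 0 := by simp [f]
  have hrec : ∀ k, f k = x k * f (k + 1) + partialProd x (k + 1) / m := by
    intro k
    have h1 := hP k
    have h2 := (hx k).ne'
    simp only [f, partialProdSum_succ, partialProd_succ]
    field_simp
    ring
  have h2b : ∀ k, 2 * b k = m / x k + m * shiftSeq x k := by
    intro k
    have hd : ∀ k, pivot m b k ≠ 0 := fun k => ((div_pos_iff_of_pos_left hm).1 (hx k)).ne'
    cases k with
    | zero =>
      have := hd 0
      simp only [hxdef, pivotRatio, pivot, shiftSeq] at this ⊢
      field_simp
      ring
    | succ k =>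
      have e1 := hd k
      have e2 := hd (k + 1)
      have e3 : 2 * b (k + 1) = pivot m b (k + 1) + m ^ 2 / pivot m b k := by rw [pivot]; ring
      rw [e3]
      simp only [hxdef, pivotRatio, shiftSeq]
      field_simp
  have hmul : (boxOperator m β n).mulVec (fun j => f j.1.natPred) =
      Pi.single ⟨1, le_refl 1, one_le⟩ 1 := by
    ext j
    rw [boxOperator_mulVec m β n hfn]
    have hbj : β j = b j.1.natPred := by simp [hb]
    rw [hbj, h2b]
    generalize hk : j.1.natPred = k
    have hj : j.1 = k.succPNat := by rw [← hk, PNat.succPNat_natPred]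
    have h1 := (hx k).ne'
    cases k with
    | zero =>
      have : j = ⟨1, le_refl 1, one_le⟩ := Subtype.ext hj
      rw [this, Pi.single_eq_same, hrec 0]
      simp only [shiftSeq, partialProd_succ]
      simp only [partialProd, Finset.range_zero, Finset.prod_empty]
      field_simp
      ring
    | succ k =>
      have : j ≠ ⟨1, le_refl 1, one_le⟩ := by
        intro hj1
        have := congrArg (fun t => (t.1 : ℕ)) hj1
        simp [hj] at this
      rw [Pi.single_eq_of_ne this]
      simp only [shiftSeq]
      rw [hrec k, hrec (k + 1), partialProd_succ x (k + 1)]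
      field_simp
      ring
  have hdet : IsUnit (boxOperator m β n).det := (h n).det_pos.ne'.isUnit
  have hinv : (greenHat m β n).mulVec (Pi.single ⟨1, le_refl 1, one_le⟩ 1) = fun j => f j.1.natPred := by
    rw [← hmul, greenHat, Matrix.mulVec_mulVec, Matrix.nonsing_inv_mul _ hdet, Matrix.one_mulVec]
  have := congrFun hinv i
  rw [Matrix.mulVec_single_one] at this
  exact this

theorem psi_eq {m : ℝ} (hm : 0 < m) {β : ℕ+ → ℝ} (h : ∀ n, (boxOperator m β n).PosDef) (n : ℕ+) :
    psi m β n = partialProd (pivotRatio m fun k => β k.succPNat) n := by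
  have hx := (posDef_boxOperator_iff hm).1 h
  have hsymm : greenHat m β n ⟨1, le_refl 1, one_le⟩ ⟨n, one_le, le_refl n⟩ =
      greenHat m β n ⟨n, one_le, le_refl n⟩ ⟨1, le_refl 1, one_le⟩ := by
    have := (isHermitian_boxOperator m β n).inv.apply ⟨1, le_refl 1, one_le⟩ ⟨n, one_le, le_refl n⟩
    simpa [greenHat] using this.symm
  rw [psi, hsymm, greenHat_one hm h]
  simp only
  have hn : (n : ℕ) = n.natPred + 1 := n.natPred_add_one.symm
  have hP : partialProd (pivotRatio m fun k => β k.succPNat) n.natPred ≠ 0 :=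
    (Finset.prod_pos fun l _ => hx l).ne'
  rw [hn, partialProdSum_succ]
  field_simp
  ring

theorem zRatio_eq {m : ℝ} (hm : 0 < m) {β : ℕ+ → ℝ} (h : ∀ n, (boxOperator m β n).PosDef)
    (n : ℕ+) : zRatio m β n = partialProdSum (pivotRatio m fun k => β k.succPNat) n /
      (m * partialProd (pivotRatio m fun k => β k.succPNat) n) := by
  rw [zRatio, psi_eq hm h, greenHat_one hm h]
  simp only [PNat.natPred, PNat.one_coe, Nat.sub_self, partialProdSum, partialProd,
    Finset.range_zero, Finset.sum_empty, Finset.prod_empty, sub_zero, mul_one, div_div]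

/-! ### Measurability. -/

theorem continuous_boxOperator (m : ℝ) (n : ℕ+) : Continuous fun β => boxOperator m β n := by
  refine continuous_matrix fun i j => ?_
  simp only [boxOperator, schrodinger, Matrix.submatrix_apply, Matrix.of_apply]
  split_ifs <;> fun_prop

theorem measurable_greenHat (m : ℝ) (n : ℕ+) (i j : Set.Icc (1 : ℕ+) n) :
    Measurable fun β => greenHat m β n i j := by
  have hc := continuous_boxOperator m n
  have h1 : Measurable fun β => (boxOperator m β n).det⁻¹ := hc.matrix_det.measurable.inv
  have h2 : Measurable fun β => (boxOperator m β n).adjugate i j :=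
    (hc.matrix_adjugate.matrix_elem i j).measurable
  simp only [greenHat, Matrix.inv_def, Matrix.smul_apply, Ring.inverse_eq_inv', smul_eq_mul]
  exact h1.mul h2

theorem measurable_psi (m : ℝ) (n : ℕ+) : Measurable fun β => psi m β n :=
  (measurable_greenHat m n _ _).mul_const m

theorem measurable_zRatio (m : ℝ) (n : ℕ+) : Measurable fun β => zRatio m β n :=
  (measurable_greenHat m n _ _).div (measurable_psi m n)

theorem measurable_lintegral_inverseGaussian {α : Type*} [MeasurableSpace α] {μ lam : α → ℝ}
    (hμ : Measurable μ) (hl : Measurable lam) {F : α → ℝ → ENNReal}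
    (hF : Measurable (Function.uncurry F)) :
    Measurable fun a => ∫⁻ p, F a p ∂inverseGaussian (μ a) (lam a) := by
  have h : ∀ a, ∫⁻ p, F a p ∂inverseGaussian (μ a) (lam a) =
      ∫⁻ p in Set.Ioi 0, ENNReal.ofReal (igDensity (μ a) (lam a) p) * F a p :=
    fun a => lintegral_inverseGaussian _ _ (hF.comp measurable_prodMk_left)
  simp_rw [h]
  refine Measurable.lintegral_prod_right' (f := fun q : α × ℝ =>
    ENNReal.ofReal (igDensity (μ q.1) (lam q.1) q.2) * F q.1 q.2) ?_
  exact (measurable_igDensity.comp ((hμ.comp measurable_fst).prodMk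
    ((hl.comp measurable_fst).prodMk measurable_snd))).ennreal_ofReal.mul hF

theorem partialProd_congr {x y : ℕ → ℝ} {n : ℕ} (h : ∀ k < n, x k = y k) :
    partialProd x n = partialProd y n :=
  Finset.prod_congr rfl fun k hk => h k (Finset.mem_range.1 hk)

theorem partialProdSum_congr {x y : ℕ → ℝ} {n : ℕ} (h : ∀ k < n, x k = y k) :
    partialProdSum x n = partialProdSum y n := by
  refine Finset.sum_congr rfl fun k hk => ?_
  have hk := Finset.mem_range.1 hk
  rw [partialProd_congr fun l hl => h l (by omega),
    partialProd_congr fun l hl => h l (by omega : l < n)]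

theorem measurable_partialProd (n : ℕ) : Measurable fun x => partialProd x n := by
  unfold partialProd; fun_prop

theorem measurable_partialProdSum (n : ℕ) : Measurable fun x => partialProdSum x n := by
  have := measurable_partialProd
  unfold partialProdSum
  exact Finset.measurable_fun_sum _ fun k _ => (this k).mul (this (k + 1))

/-! ### The past of a process as a random sequence. -/

/-- The values `Z 1, …, Z n` of a process, followed by zeros. -/
def pastValues {Ω : Type*} (Z : ℕ+ → Ω → ℝ) (n : ℕ+) (ω : Ω) (k : ℕ+) : ℝ :=
  if k ≤ n then Z k ω else 0

section Past

variable {Ω : Type*} {Z : ℕ+ → Ω → ℝ}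

theorem pastValues_of_le {n k : ℕ+} (h : k ≤ n) (ω : Ω) : pastValues Z n ω k = Z k ω := if_pos h

theorem pastValues_succ (n : ℕ+) (ω : Ω) :
    pastValues Z (n + 1) ω = Function.update (pastValues Z n ω) (n + 1) (Z (n + 1) ω) := by
  ext k
  by_cases hk : k = n + 1
  · subst hk; simp [pastValues]
  · rw [Function.update_of_ne hk, pastValues, pastValues]
    have : k ≤ n + 1 ↔ k ≤ n := by
      rw [le_iff_lt_or_eq, PNat.lt_add_one_iff]; simp [hk]
    simp [this]

theorem measurable_pastValues [MeasurableSpace Ω] (hZ : ∀ n, Measurable (Z n)) (n : ℕ+) :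
    Measurable (pastValues Z n) := by
  refine measurable_pi_lambda _ fun k => ?_
  simp only [pastValues]
  split_ifs
  · exact hZ k
  · exact measurable_const

/-- Events of the past become Borel conditions on one random sequence, so conditional laws can be
tested on functions of `pastValues`. -/
theorem exists_preimage_pastValues {n : ℕ+} {A : Set Ω} (hA : MeasurableSet[history Z n] A) :
    ∃ C : Set (ℕ+ → ℝ), MeasurableSet C ∧ pastValues Z n ⁻¹' C = A := by
  have h : history Z n ≤ MeasurableSpace.comap (pastValues Z n) inferInstance := by
    refine iSup₂_le fun k hk => ?_
    have : Z k = (fun h : ℕ+ → ℝ => h k) ∘ pastValues Z n := by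
      ext ω; exact (pastValues_of_le hk ω).symm
    rw [this, ← MeasurableSpace.comap_comp]
    exact MeasurableSpace.comap_mono (measurable_pi_apply k).comap_le
  exact h A hA

theorem history_le [MeasurableSpace Ω] (hZ : ∀ n, Measurable (Z n)) (n : ℕ+) :
    history Z n ≤ ‹MeasurableSpace Ω› :=
  iSup₂_le fun k _ => (hZ k).comap_le

theorem measurable_history {n k : ℕ+} (h : k ≤ n) : Measurable[history Z n] (Z k) :=
  (comap_measurable (Z k)).mono (le_iSup₂ (f := fun (k : ℕ+) (_ : k ≤ n) =>
    MeasurableSpace.comap (Z k) inferInstance) k h) le_rfl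

end Past

/-! ### Joint laws of the past of `Z` and of `ψ`. -/

theorem ae_pos_of_map_eq {Ω : Type*} [MeasurableSpace Ω] {P : Measure Ω} {m : ℝ} {x : Ω → ℕ → ℝ}
    (hm : 0 < m) (hx : Measurable x)
    (hlaw : P.map x = Measure.infinitePi fun _ : ℕ => inverseGaussian 1 m) :
    ∀ᵐ ω ∂P, ∀ k, 0 < x ω k := by
  have h := ae_pos_infinitePi_inverseGaussian hm
  rw [← hlaw] at h
  exact ae_of_ae_map hx.aemeasurable h

theorem ae_zRatio_pos {Ω : Type*} [MeasurableSpace Ω] {P : Measure Ω} {m : ℝ} {x : Ω → ℕ → ℝ}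
    {Z : ℕ+ → Ω → ℝ} (hm : 0 < m) (hx : Measurable x)
    (hlaw : P.map x = Measure.infinitePi fun _ : ℕ => inverseGaussian 1 m)
    (hZ : ∀ᵐ ω ∂P, ∀ n : ℕ+, Z n ω = partialProdSum (x ω) n / (m * partialProd (x ω) n)) :
    ∀ᵐ ω ∂P, ∀ n, 0 < Z n ω := by
  filter_upwards [ae_pos_of_map_eq hm hx hlaw, hZ] with ω h1 h2 n
  have hP : ∀ k, 0 < partialProd (x ω) k := fun k => Finset.prod_pos fun l _ => h1 l
  rw [h2]
  refine div_pos (Finset.sum_pos (fun k _ => mul_pos (hP _) (hP _)) ?_) (mul_pos hm (hP _))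
  simp

section Disintegration

variable {Ω : Type*} [MeasurableSpace Ω] {P : Measure Ω} [IsProbabilityMeasure P] {m : ℝ}
  {x : Ω → ℕ → ℝ} {ψ Z : ℕ+ → Ω → ℝ}

/-- The past of `Z` up to `n` and `ψ n` are almost surely functions of `x_0, …, x_{n-1}`, which are
independent of `x_n`. -/
theorem lintegral_pastValues_indep (hm : 0 < m) (hx : Measurable x)
    (hlaw : P.map x = Measure.infinitePi fun _ : ℕ => inverseGaussian 1 m)
    (hψ : ∀ᵐ ω ∂P, ∀ n : ℕ+, ψ n ω = partialProd (x ω) n)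
    (hZ : ∀ᵐ ω ∂P, ∀ n : ℕ+, Z n ω = partialProdSum (x ω) n / (m * partialProd (x ω) n))
    (n : ℕ+) {F : (ℕ+ → ℝ) → ℝ → ℝ → ENNReal}
    (hF : Measurable fun q : (ℕ+ → ℝ) × ℝ × ℝ => F q.1 q.2.1 q.2.2) :
    ∫⁻ ω, F (pastValues Z n ω) (ψ n ω) (x ω n) ∂P =
      ∫⁻ ω, ∫⁻ y, F (pastValues Z n ω) (ψ n ω) y ∂inverseGaussian 1 m ∂P := by
  have := isProbabilityMeasure_inverseGaussian one_pos hm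
  have hxk : ∀ k, Measurable fun ω => x ω k := fun k => (measurable_pi_apply k).comp hx
  have hmap : ∀ k, P.map (fun ω => x ω k) = inverseGaussian 1 m := fun k => by
    rw [← Measure.infinitePi_map_eval (fun _ : ℕ => inverseGaussian 1 m) k, ← hlaw,
      Measure.map_map (measurable_pi_apply k) hx]
    rfl
  have hind : ProbabilityTheory.iIndepFun (fun k ω => x ω k) P := by
    rw [ProbabilityTheory.iIndepFun_iff_map_fun_eq_infinitePi_map hxk]
    simp_rw [hmap]
    exact hlaw
  have h2 := hind.indepFun_finset (Finset.range n) {(n : ℕ)} (by simp) hxk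
  -- Padding by zeros is harmless: the partial products and sums up to `n` use only indices below
  -- `n`.
  let ext0 : (Finset.range n → ℝ) → ℕ → ℝ := fun y k =>
    if h : k ∈ Finset.range n then y ⟨k, h⟩ else 0
  have hext0 : Measurable ext0 := by
    refine measurable_pi_lambda _ fun k => ?_
    simp only [ext0]
    split_ifs <;> fun_prop
  let g : (Finset.range n → ℝ) → (ℕ+ → ℝ) × ℝ := fun y =>
    (pastValues (fun k y => partialProdSum (ext0 y) k / (m * partialProd (ext0 y) k)) n y,
      partialProd (ext0 y) n)
  have hg : Measurable g := by
    refine Measurable.prodMk (measurable_pastValues (fun k => ?_) n)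
      ((measurable_partialProd n).comp hext0)
    exact ((measurable_partialProdSum k).comp hext0).div
      (((measurable_partialProd k).comp hext0).const_mul m)
  have h3 := h2.comp hg
    (measurable_pi_apply (⟨n, Finset.mem_singleton_self _⟩ : ({(n : ℕ)} : Finset ℕ)))
  set G : Ω → (ℕ+ → ℝ) × ℝ := g ∘ fun ω (k : Finset.range n) => x ω k with hG
  have hGm : Measurable G := hg.comp (measurable_pi_lambda _ fun k => hxk k)
  have h4 := (ProbabilityTheory.indepFun_iff_map_prod_eq_prod_map_map hGm.aemeasurable
    (hxk n).aemeasurable).1 h3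
  have hGe : ∀ᵐ ω ∂P, (pastValues Z n ω, ψ n ω) = G ω := by
    filter_upwards [hψ, hZ] with ω h5 h6
    have he : ∀ k < (n : ℕ), x ω k = ext0 (fun k : Finset.range n => x ω k) k := by
      intro k hk
      simp only [ext0]
      rw [dif_pos (Finset.mem_range.2 hk)]
    refine Prod.ext ?_ ?_
    · ext k
      simp only [hG, g, Function.comp_apply, pastValues]
      split_ifs with hk
      · have hk' : (k : ℕ) ≤ n := PNat.coe_le_coe _ _ |>.2 hk
        rw [h6, partialProd_congr fun l hl => he l (by omega),
          partialProdSum_congr fun l hl => he l (by omega)]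
      · rfl
    · simp only [hG, g, Function.comp_apply]
      rw [h5, partialProd_congr he]
  have hF' : Measurable fun q : ((ℕ+ → ℝ) × ℝ) × ℝ => F q.1.1 q.1.2 q.2 :=
    hF.comp (by fun_prop : Measurable fun q : ((ℕ+ → ℝ) × ℝ) × ℝ => (q.1.1, q.1.2, q.2))
  calc ∫⁻ ω, F (pastValues Z n ω) (ψ n ω) (x ω n) ∂P
      = ∫⁻ ω, F (G ω).1 (G ω).2 (x ω n) ∂P := by
        refine lintegral_congr_ae ?_
        filter_upwards [hGe] with ω h
        rw [← h]
    _ = ∫⁻ q, F q.1.1 q.1.2 q.2 ∂((P.map G).prod (inverseGaussian 1 m)) := by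
        rw [← hmap n, ← h4, lintegral_map hF' (hGm.prodMk (hxk n))]
    _ = ∫⁻ ω, ∫⁻ y, F (G ω).1 (G ω).2 y ∂inverseGaussian 1 m ∂P := by
        rw [lintegral_prod _ hF'.aemeasurable,
          lintegral_map hF'.lintegral_prod_right' hGm]
    _ = _ := by
        refine lintegral_congr_ae ?_
        filter_upwards [hGe] with ω h
        rw [← h]

/-- The joint law of `(Z 1, …, Z n)`, `Z (n + 1)` and `ψ (n + 1)`, from the conditional law of
`ψ n` given `(Z 1, …, Z n)`. -/
theorem lintegral_succ_of_lintegral (hm : 0 < m) (hx : Measurable x)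
    (hlaw : P.map x = Measure.infinitePi fun _ : ℕ => inverseGaussian 1 m)
    (hψ : ∀ᵐ ω ∂P, ∀ n : ℕ+, ψ n ω = partialProd (x ω) n)
    (hZ : ∀ᵐ ω ∂P, ∀ n : ℕ+, Z n ω = partialProdSum (x ω) n / (m * partialProd (x ω) n))
    (n : ℕ+)
    (h : ∀ F : (ℕ+ → ℝ) → ℝ → ENNReal, Measurable (Function.uncurry F) →
      ∫⁻ ω, F (pastValues Z n ω) (ψ n ω) ∂P =
        ∫⁻ ω, ∫⁻ p, F (pastValues Z n ω) p ∂inverseGaussian 1 (1 / Z n ω) ∂P)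
    {F : (ℕ+ → ℝ) → ℝ → ℝ → ENNReal}
    (hF : Measurable fun q : (ℕ+ → ℝ) × ℝ × ℝ => F q.1 q.2.1 q.2.2) :
    ∫⁻ ω, F (pastValues Z n ω) (Z (n + 1) ω) (ψ (n + 1) ω) ∂P =
      ∫⁻ ω, ∫⁻ y, ∫⁻ p, F (pastValues Z n ω) (Z n ω / m * (1 / y)) p
        ∂inverseGaussian 1 (1 / (Z n ω / m * (1 / y)))
        ∂inverseGaussian (1 / (m + 1 / Z n ω)) 1 ∂P := by
  have hF3 : ∀ {α : Type} [MeasurableSpace α] {u : α → ℕ+ → ℝ} {v w : α → ℝ}, Measurable u →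
      Measurable v → Measurable w → Measurable fun a => F (u a) (v a) (w a) :=
    fun hu hv hw => hF.comp (hu.prodMk (hv.prodMk hw))
  calc ∫⁻ ω, F (pastValues Z n ω) (Z (n + 1) ω) (ψ (n + 1) ω) ∂P
      -- The recursion `Z_{n+1} = Z_n/x_n + ψ_n/m`, `ψ_{n+1} = ψ_n x_n`. `Z_n` is read off as entry
      -- `n` of the past, so the integrand has the form required by the next two steps.
      = ∫⁻ ω, F (pastValues Z n ω) (pastValues Z n ω n / x ω n + ψ n ω / m)
          (ψ n ω * x ω n) ∂P := by
        refine lintegral_congr_ae ?_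
        filter_upwards [hψ, hZ, ae_pos_of_map_eq hm hx hlaw] with ω h1 h2 h3
        have hP : ∀ k, partialProd (x ω) k ≠ 0 := fun k => (Finset.prod_pos fun l _ => h3 l).ne'
        have h4 := (h3 n).ne'
        have h5 := hP n
        rw [pastValues_of_le le_rfl, h1, h1, h2 (n + 1), h2 n, PNat.add_coe, PNat.one_coe,
          partialProdSum_succ, partialProd_succ]
        congr 1
        field_simp
    _ = ∫⁻ ω, ∫⁻ y, F (pastValues Z n ω) (pastValues Z n ω n / y + ψ n ω / m)
          (ψ n ω * y) ∂inverseGaussian 1 m ∂P :=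
        lintegral_pastValues_indep hm hx hlaw hψ hZ n
          (F := fun h p y => F h (h n / y + p / m) (p * y))
          (hF3 (by fun_prop) (by fun_prop) (by fun_prop))
    _ = ∫⁻ ω, ∫⁻ p, ∫⁻ y, F (pastValues Z n ω) (pastValues Z n ω n / y + p / m)
          (p * y) ∂inverseGaussian 1 m ∂inverseGaussian 1 (1 / Z n ω) ∂P := by
        refine h (fun h p => ∫⁻ y, F h (h n / y + p / m) (p * y) ∂inverseGaussian 1 m) ?_
        exact measurable_lintegral_inverseGaussian (α := (ℕ+ → ℝ) × ℝ)
          (F := fun q y => F q.1 (q.1 n / y + q.2 / m) (q.2 * y)) measurable_const measurable_const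
          (hF3 (by fun_prop) (by fun_prop) (by fun_prop))
    _ = _ := by
        refine lintegral_congr_ae ?_
        filter_upwards [ae_zRatio_pos hm hx hlaw hZ] with ω hpos
        rw [pastValues_of_le le_rfl]
        exact lintegral_inverseGaussian_exchange (hpos n) hm
          (F := F (pastValues Z n ω)) (hF3 measurable_const (by fun_prop) (by fun_prop))

/-- The conditional law of `ψ n` given `(Z 1, …, Z n)` is `IG(1, 1 / Z n)`. -/
theorem lintegral_pastValues (hm : 0 < m) (hx : Measurable x)
    (hlaw : P.map x = Measure.infinitePi fun _ : ℕ => inverseGaussian 1 m)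
    (hψ : ∀ᵐ ω ∂P, ∀ n : ℕ+, ψ n ω = partialProd (x ω) n)
    (hZ : ∀ᵐ ω ∂P, ∀ n : ℕ+, Z n ω = partialProdSum (x ω) n / (m * partialProd (x ω) n))
    (n : ℕ+) : ∀ F : (ℕ+ → ℝ) → ℝ → ENNReal, Measurable (Function.uncurry F) →
      ∫⁻ ω, F (pastValues Z n ω) (ψ n ω) ∂P =
        ∫⁻ ω, ∫⁻ p, F (pastValues Z n ω) p ∂inverseGaussian 1 (1 / Z n ω) ∂P := by
  induction n using PNat.recOn with
  | one =>
    intro F hF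
    have hxk : Measurable fun ω => x ω 0 := (measurable_pi_apply 0).comp hx
    have := isProbabilityMeasure_inverseGaussian one_pos hm
    have hmap : P.map (fun ω => x ω 0) = inverseGaussian 1 m := by
      rw [← Measure.infinitePi_map_eval (fun _ : ℕ => inverseGaussian 1 m) 0, ← hlaw,
        Measure.map_map (measurable_pi_apply 0) hx]
      rfl
    -- At the first vertex the past is deterministic, `Z_1 = 1/m`, and `ψ_1 = x_0` has law `IG(1, m)
    -- = IG(1, 1/Z_1)`.
    have hfirst : ∀ᵐ ω ∂P, Z 1 ω = 1 / m ∧ ψ 1 ω = x ω 0 ∧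
        pastValues Z 1 ω = fun k => if k ≤ 1 then 1 / m else 0 := by
      filter_upwards [hψ, hZ, ae_pos_of_map_eq hm hx hlaw] with ω h1 h2 h3
      have h4 := (h3 0).ne'
      have hz : Z 1 ω = 1 / m := by
        rw [h2]
        simp [partialProdSum, partialProd]
        field_simp
      refine ⟨hz, ?_, ?_⟩
      · rw [h1]; simp [partialProd]
      · ext k
        simp only [pastValues]
        split_ifs with hk
        · rw [← hz, le_antisymm hk one_le]
        · rfl
    set c : ℕ+ → ℝ := fun k => if k ≤ 1 then 1 / m else 0
    have e1 : ∫⁻ ω, F (pastValues Z 1 ω) (ψ 1 ω) ∂P = ∫⁻ ω, F c (x ω 0) ∂P := by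
      refine lintegral_congr_ae ?_
      filter_upwards [hfirst] with ω h
      rw [h.2.1, h.2.2]
    have e2 : ∫⁻ ω, ∫⁻ p, F (pastValues Z 1 ω) p ∂inverseGaussian 1 (1 / Z 1 ω) ∂P =
        ∫⁻ _, ∫⁻ p, F c p ∂inverseGaussian 1 m ∂P := by
      refine lintegral_congr_ae ?_
      filter_upwards [hfirst] with ω h
      rw [h.1, h.2.2, one_div_one_div]
    rw [e1, e2, lintegral_const, measure_univ, mul_one, ← hmap,
      lintegral_map (f := F c) (hF.comp measurable_prodMk_left) hxk]
  | succ n ih =>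
    intro F hF
    have hU : Measurable fun q : (ℕ+ → ℝ) × ℝ => Function.update q.1 (n + 1) q.2 :=
      measurable_update'
    simp_rw [pastValues_succ]
    -- The joint law is applied to both sides: to `F`, and to the average of `F` over its last
    -- argument. The second leaves a redundant integration of a constant against a probability
    -- measure.
    rw [lintegral_succ_of_lintegral hm hx hlaw hψ hZ n ih
        (F := fun h w p => F (Function.update h (n + 1) w) p)
        (hF.comp ((hU.comp (by fun_prop : Measurable fun q : (ℕ+ → ℝ) × ℝ × ℝ =>
          (q.1, q.2.1))).prodMk (by fun_prop))),
      lintegral_succ_of_lintegral hm hx hlaw hψ hZ n ih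
        (F := fun h w _ => ∫⁻ p, F (Function.update h (n + 1) w) p ∂inverseGaussian 1 (1 / w))
        (measurable_lintegral_inverseGaussian (α := (ℕ+ → ℝ) × ℝ × ℝ)
          (F := fun q p => F (Function.update q.1 (n + 1) q.2.1) p)
          measurable_const (by fun_prop)
          (hF.comp ((hU.comp (by fun_prop : Measurable fun q : ((ℕ+ → ℝ) × ℝ × ℝ) × ℝ =>
          (q.1.1, q.1.2.1))).prodMk (by fun_prop))))]
    refine lintegral_congr_ae ?_
    filter_upwards [ae_zRatio_pos hm hx hlaw hZ] with ω hpos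
    refine lintegral_congr_ae ?_
    filter_upwards [ae_pos_inverseGaussian _ _] with y hy
    have hz := hpos n
    have := isProbabilityMeasure_inverseGaussian one_pos
      (by positivity : 0 < 1 / (Z n ω / m * (1 / y)))
    rw [lintegral_const, measure_univ, mul_one]

end Disintegration

/-! ### Conditional laws and the Markov property from integrals over events. -/

section CondLaw

variable {Ω : Type*} {𝓖 mΩ : MeasurableSpace Ω} {P : Measure Ω} [IsProbabilityMeasure P]

theorem hasCondLaw_of_measure_inter (h𝓖 : 𝓖 ≤ mΩ) {X : Ω → ℝ}
    (hX : Measurable X) {κ : Ω → Measure ℝ}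
    (hκ : ∀ B, MeasurableSet B → Measurable[𝓖] fun ω => κ ω B)
    (hprob : ∀ᵐ ω ∂P, IsProbabilityMeasure (κ ω))
    (h : ∀ A, MeasurableSet[𝓖] A → ∀ B, MeasurableSet B →
      P (A ∩ X ⁻¹' B) = ∫⁻ ω in A, κ ω B ∂P) : HasCondLaw P 𝓖 X κ := by
  intro B hB
  have hm : Measurable[𝓖] fun ω => (κ ω).real B := (hκ B hB).ennreal_toReal
  have hint : Integrable (fun ω => (κ ω).real B) P := by
    refine Integrable.of_bound (hm.mono h𝓖 le_rfl).aestronglyMeasurable 1 ?_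
    filter_upwards [hprob] with ω hω
    rw [Real.norm_of_nonneg measureReal_nonneg]
    exact measureReal_le_one
  refine (ae_eq_condExp_of_forall_setIntegral_eq h𝓖 ?_ ?_ ?_ ?_).symm
  · exact (integrable_const 1).indicator (hX hB)
  · exact fun s _ _ => hint.integrableOn
  · intro A hA _
    rw [setIntegral_indicator (hX hB), setIntegral_const, smul_eq_mul, mul_one, measureReal_def,
      h A hA B hB, ← integral_toReal (((hκ B hB).mono h𝓖 le_rfl).aemeasurable)]
    · rfl
    · refine ae_restrict_of_ae ?_
      filter_upwards [hprob] with ω hω using measure_lt_top _ _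
  · exact hm.stronglyMeasurable.aestronglyMeasurable

/-- The conditional probability given the whole past is a function of `Z n`, so conditioning further
on `Z n` leaves it unchanged; the tower property concludes. -/
theorem isMarkovProcess_of_hasCondLaw {Z : ℕ+ → Ω → ℝ} (hZ : ∀ n, Measurable (Z n))
    {κ : ℝ → Measure ℝ} (hκ : ∀ B, MeasurableSet B → Measurable fun z => κ z B)
    (h : ∀ n, HasCondLaw P (history Z n) (Z (n + 1)) fun ω => κ (Z n ω)) :
    IsMarkovProcess P Z := by
  refine ⟨hZ, fun n B hB => ?_⟩
  have hle : MeasurableSpace.comap (Z n) inferInstance ≤ history Z n :=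
    (measurable_history le_rfl).comap_le
  have h1 := h n B hB
  have hmeas : StronglyMeasurable[MeasurableSpace.comap (Z n) inferInstance]
      fun ω => (κ (Z n ω)).real B :=
    ((hκ B hB).ennreal_toReal.comp (comap_measurable (Z n))).stronglyMeasurable
  have hint : Integrable (fun ω => (κ (Z n ω)).real B) P := integrable_condExp.congr h1
  have h2 := condExp_condExp_of_le (μ := P)
    (f := (Z (n + 1) ⁻¹' B).indicator fun _ => (1 : ℝ)) hle (history_le hZ n)
  have h3 := condExp_congr_ae (m := MeasurableSpace.comap (Z n) inferInstance) h1
  rw [condExp_of_stronglyMeasurable (hZ n).comap_le hmeas hint] at h3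
  exact h1.trans (h3.symm.trans h2)

end CondLaw

/-! ### Conditional laws of `ψ` and `Z`, and failure of measurability of `ψ`. -/

section Disintegration

variable {Ω : Type*} [MeasurableSpace Ω] {P : Measure Ω} [IsProbabilityMeasure P] {m : ℝ}
  {x : Ω → ℕ → ℝ} {ψ Z : ℕ+ → Ω → ℝ}

theorem measure_inter_preimage_psi (hm : 0 < m) (hx : Measurable x)
    (hlaw : P.map x = Measure.infinitePi fun _ : ℕ => inverseGaussian 1 m)
    (hψ : ∀ᵐ ω ∂P, ∀ n : ℕ+, ψ n ω = partialProd (x ω) n)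
    (hZ : ∀ᵐ ω ∂P, ∀ n : ℕ+, Z n ω = partialProdSum (x ω) n / (m * partialProd (x ω) n))
    (mψ : ∀ n, Measurable (ψ n)) (mZ : ∀ n, Measurable (Z n)) (n : ℕ+)
    {A : Set Ω} (hA : MeasurableSet[history Z n] A) {B : Set ℝ} (hB : MeasurableSet B) :
    P (A ∩ ψ n ⁻¹' B) = ∫⁻ ω in A, inverseGaussian 1 (1 / Z n ω) B ∂P := by
  have hA' := history_le mZ n A hA
  obtain ⟨C, hC, rfl⟩ := exists_preimage_pastValues hA
  have h := lintegral_pastValues hm hx hlaw hψ hZ n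
    (fun h p => (C ×ˢ B).indicator 1 (h, p)) (measurable_one.indicator (hC.prod hB))
  have e1 : ∀ ω, (C ×ˢ B).indicator (1 : (ℕ+ → ℝ) × ℝ → ENNReal) (pastValues Z n ω, ψ n ω) =
      (pastValues Z n ⁻¹' C ∩ ψ n ⁻¹' B).indicator 1 ω := fun ω => rfl
  have e2 : ∀ ω, ∫⁻ p, (C ×ˢ B).indicator (1 : (ℕ+ → ℝ) × ℝ → ENNReal) (pastValues Z n ω, p)
      ∂inverseGaussian 1 (1 / Z n ω) =
      (pastValues Z n ⁻¹' C).indicator (fun ω => inverseGaussian 1 (1 / Z n ω) B) ω := by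
    intro ω
    by_cases hω : pastValues Z n ω ∈ C
    · rw [Set.indicator_of_mem (by exact hω), ← lintegral_indicator_one hB]
      refine lintegral_congr fun p => ?_
      by_cases hp : p ∈ B <;> simp [hω, hp]
    · rw [Set.indicator_of_notMem (by exact hω)]
      simp [hω]
  simp_rw [e1, e2] at h
  rw [← lintegral_indicator hA', ← h, lintegral_indicator_one (hA'.inter (mψ n hB))]

theorem measure_inter_preimage_zRatio_succ (hm : 0 < m) (hx : Measurable x)
    (hlaw : P.map x = Measure.infinitePi fun _ : ℕ => inverseGaussian 1 m)
    (hψ : ∀ᵐ ω ∂P, ∀ n : ℕ+, ψ n ω = partialProd (x ω) n)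
    (hZ : ∀ᵐ ω ∂P, ∀ n : ℕ+, Z n ω = partialProdSum (x ω) n / (m * partialProd (x ω) n))
    (mZ : ∀ n, Measurable (Z n)) (n : ℕ+)
    {A : Set Ω} (hA : MeasurableSet[history Z n] A) {B : Set ℝ} (hB : MeasurableSet B) :
    P (A ∩ Z (n + 1) ⁻¹' B) = ∫⁻ ω in A, (inverseGaussian (1 / (m + 1 / Z n ω)) 1).map
      (fun y => Z n ω / m * (1 / y)) B ∂P := by
  have hA' := history_le mZ n A hA
  obtain ⟨C, hC, rfl⟩ := exists_preimage_pastValues hA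
  have h := lintegral_succ_of_lintegral hm hx hlaw hψ hZ n
    (lintegral_pastValues hm hx hlaw hψ hZ n)
    (F := fun h w _ => (C ×ˢ B).indicator 1 (h, w))
    ((measurable_one.indicator (hC.prod hB)).comp (by fun_prop :
      Measurable fun q : (ℕ+ → ℝ) × ℝ × ℝ => (q.1, q.2.1)))
  have e1 : ∀ ω, (C ×ˢ B).indicator (1 : (ℕ+ → ℝ) × ℝ → ENNReal) (pastValues Z n ω, Z (n + 1) ω) =
      (pastValues Z n ⁻¹' C ∩ Z (n + 1) ⁻¹' B).indicator 1 ω := fun ω => rfl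
  simp_rw [e1] at h
  rw [lintegral_indicator_one (hA'.inter (mZ (n + 1) hB))] at h
  rw [h, ← lintegral_indicator hA']
  refine lintegral_congr_ae ?_
  filter_upwards [ae_zRatio_pos hm hx hlaw hZ] with ω hpos
  have hz := hpos n
  have hmeas : Measurable fun y : ℝ => Z n ω / m * (1 / y) := by fun_prop
  have e2 : ∫⁻ y, ∫⁻ _, (C ×ˢ B).indicator (1 : (ℕ+ → ℝ) × ℝ → ENNReal)
        (pastValues Z n ω, Z n ω / m * (1 / y)) ∂inverseGaussian 1 (1 / (Z n ω / m * (1 / y)))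
        ∂inverseGaussian (1 / (m + 1 / Z n ω)) 1 =
      ∫⁻ y, (C ×ˢ B).indicator (1 : (ℕ+ → ℝ) × ℝ → ENNReal)
        (pastValues Z n ω, Z n ω / m * (1 / y)) ∂inverseGaussian (1 / (m + 1 / Z n ω)) 1 := by
    refine lintegral_congr_ae ?_
    filter_upwards [ae_pos_inverseGaussian _ _] with y hy
    have := isProbabilityMeasure_inverseGaussian one_pos
      (by positivity : 0 < 1 / (Z n ω / m * (1 / y)))
    rw [lintegral_const, measure_univ, mul_one]
  rw [e2]
  by_cases hω : pastValues Z n ω ∈ C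
  · rw [Set.indicator_of_mem (by exact hω), Measure.map_apply hmeas hB,
      ← lintegral_indicator_one (hmeas hB)]
    refine lintegral_congr fun y => ?_
    by_cases hy : Z n ω / m * (1 / y) ∈ B
    · rw [Set.indicator_of_mem (Set.mk_mem_prod hω hy), Set.indicator_of_mem (by exact hy)]
      rfl
    · rw [Set.indicator_of_notMem (fun h => hy h.2), Set.indicator_of_notMem (by exact hy)]
  · rw [Set.indicator_of_notMem (by exact hω)]
    simp [hω]

theorem measurable_inverseGaussian_apply {α : Type*} [MeasurableSpace α] {μ lam : α → ℝ}
    (hμ : Measurable μ) (hl : Measurable lam) {B : Set (α × ℝ)} (hB : MeasurableSet B) :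
    Measurable fun a => inverseGaussian (μ a) (lam a) (Prod.mk a ⁻¹' B) := by
  have h : ∀ a, inverseGaussian (μ a) (lam a) (Prod.mk a ⁻¹' B) =
      ∫⁻ p, B.indicator 1 (a, p) ∂inverseGaussian (μ a) (lam a) := fun a => by
    rw [← lintegral_indicator_one (measurable_prodMk_left hB)]
    rfl
  simp_rw [h]
  exact measurable_lintegral_inverseGaussian hμ hl (measurable_one.indicator hB)

theorem hasCondLaw_psi (hm : 0 < m) (hx : Measurable x)
    (hlaw : P.map x = Measure.infinitePi fun _ : ℕ => inverseGaussian 1 m)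
    (hψ : ∀ᵐ ω ∂P, ∀ n : ℕ+, ψ n ω = partialProd (x ω) n)
    (hZ : ∀ᵐ ω ∂P, ∀ n : ℕ+, Z n ω = partialProdSum (x ω) n / (m * partialProd (x ω) n))
    (mψ : ∀ n, Measurable (ψ n)) (mZ : ∀ n, Measurable (Z n)) (n : ℕ+) :
    HasCondLaw P (history Z n) (ψ n) fun ω => inverseGaussian 1 (1 / Z n ω) := by
  refine hasCondLaw_of_measure_inter (history_le mZ n) (mψ n) ?_ ?_
    fun A hA B hB => measure_inter_preimage_psi hm hx hlaw hψ hZ mψ mZ n hA hB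
  · intro B hB
    have h : Measurable fun z : ℝ => inverseGaussian 1 (1 / z) B :=
      measurable_inverseGaussian_apply (B := Prod.snd ⁻¹' B) measurable_const (by fun_prop)
        (measurable_snd hB)
    exact h.comp (measurable_history le_rfl)
  · filter_upwards [ae_zRatio_pos hm hx hlaw hZ] with ω hpos
    exact isProbabilityMeasure_inverseGaussian one_pos (one_div_pos.2 (hpos n))

theorem measurable_transition (m : ℝ) {B : Set ℝ} (hB : MeasurableSet B) :
    Measurable fun z : ℝ =>
      (inverseGaussian (1 / (m + 1 / z)) 1).map (fun y => z / m * (1 / y)) B := by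
  have h : ∀ z : ℝ, (inverseGaussian (1 / (m + 1 / z)) 1).map (fun y => z / m * (1 / y)) B =
      inverseGaussian (1 / (m + 1 / z)) 1
        (Prod.mk z ⁻¹' ((fun q : ℝ × ℝ => q.1 / m * (1 / q.2)) ⁻¹' B)) :=
    fun z => Measure.map_apply (by fun_prop) hB
  simp_rw [h]
  have hmeas : Measurable fun q : ℝ × ℝ => q.1 / m * (1 / q.2) := by fun_prop
  exact measurable_inverseGaussian_apply (by fun_prop) measurable_const (hmeas hB)

theorem hasCondLaw_zRatio_succ (hm : 0 < m) (hx : Measurable x)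
    (hlaw : P.map x = Measure.infinitePi fun _ : ℕ => inverseGaussian 1 m)
    (hψ : ∀ᵐ ω ∂P, ∀ n : ℕ+, ψ n ω = partialProd (x ω) n)
    (hZ : ∀ᵐ ω ∂P, ∀ n : ℕ+, Z n ω = partialProdSum (x ω) n / (m * partialProd (x ω) n))
    (mZ : ∀ n, Measurable (Z n)) (n : ℕ+) :
    HasCondLaw P (history Z n) (Z (n + 1)) fun ω =>
      (inverseGaussian (1 / (m + 1 / Z n ω)) 1).map fun y => Z n ω / m * (1 / y) := by
  refine hasCondLaw_of_measure_inter (history_le mZ n) (mZ (n + 1)) ?_ ?_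
    fun A hA B hB => measure_inter_preimage_zRatio_succ hm hx hlaw hψ hZ mZ n hA hB
  · exact fun B hB => (measurable_transition m hB).comp (measurable_history le_rfl)
  · filter_upwards [ae_zRatio_pos hm hx hlaw hZ] with ω hpos
    have hz := hpos n
    have := isProbabilityMeasure_inverseGaussian
      (by positivity : 0 < 1 / (m + 1 / Z n ω)) one_pos
    exact Measure.isProbabilityMeasure_map (by fun_prop)

/-- The event `{ψ n > 1}` does not belong, even up to null sets, to `σ(Z 1, …, Z n)`. -/
theorem not_ae_eq_preimage_psi (hm : 0 < m) (hx : Measurable x)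
    (hlaw : P.map x = Measure.infinitePi fun _ : ℕ => inverseGaussian 1 m)
    (hψ : ∀ᵐ ω ∂P, ∀ n : ℕ+, ψ n ω = partialProd (x ω) n)
    (hZ : ∀ᵐ ω ∂P, ∀ n : ℕ+, Z n ω = partialProdSum (x ω) n / (m * partialProd (x ω) n))
    (mψ : ∀ n, Measurable (ψ n)) (mZ : ∀ n, Measurable (Z n)) (n : ℕ+)
    {A : Set Ω} (hA : MeasurableSet[history Z n] A) : ¬ ψ n ⁻¹' Set.Ioi 1 =ᵐ[P] A := by
  intro hae
  have hpos := ae_zRatio_pos hm hx hlaw hZ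
  -- The conditional law charges every set containing a nonempty interval of positive reals, so an
  -- event of the past of `Z` that almost surely excludes `ψ n ∈ B` is null. For `A` with `B = (-∞,
  -- 1]` and `Aᶜ` with `B = (1, ∞)`, both would be null.
  have key : ∀ {D : Set Ω}, MeasurableSet[history Z n] D → ∀ {B : Set ℝ}, MeasurableSet B →
      ∀ {a b : ℝ}, 0 ≤ a → a < b → Set.Ioo a b ⊆ B → P (D ∩ ψ n ⁻¹' B) = 0 → P D = 0 := by
    intro D hD B hB a b ha hab hsub h0
    have hD' := history_le mZ n D hD
    rw [measure_inter_preimage_psi hm hx hlaw hψ hZ mψ mZ n hD hB,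
      setLIntegral_eq_zero_iff hD'] at h0
    · have h1 : ∀ᵐ ω ∂P, ω ∉ D := by
        filter_upwards [h0, hpos] with ω h2 h3 hω
        exact (inverseGaussian_pos_of_subset (one_div_pos.2 (h3 n)) ha hab hsub).ne' (h2 hω)
      simpa [ae_iff] using h1
    · have h : Measurable fun z : ℝ => inverseGaussian 1 (1 / z) B :=
        measurable_inverseGaussian_apply (B := Prod.snd ⁻¹' B) measurable_const (by fun_prop)
          (measurable_snd hB)
      exact h.comp (mZ n)
  have h1 : P A = 0 := by
    refine key hA measurableSet_Iic le_rfl one_pos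
      (fun p hp => hp.2.le : Set.Ioo 0 1 ⊆ Set.Iic (1 : ℝ)) ?_
    refine measure_mono_null ?_ (ae_eq_set.1 hae).2
    exact fun ω hω => ⟨hω.1, fun h : 1 < ψ n ω => h.not_ge hω.2⟩
  have h2 : P Aᶜ = 0 := by
    refine key hA.compl measurableSet_Ioi zero_le_one one_lt_two
      (fun p hp => hp.1 : Set.Ioo 1 2 ⊆ Set.Ioi (1 : ℝ)) ?_
    refine measure_mono_null ?_ (ae_eq_set.1 hae).1
    exact fun ω hω => ⟨hω.2, hω.1⟩
  have h3 := prob_add_prob_compl (μ := P) (history_le mZ n A hA)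
  rw [h1, h2] at h3
  simp at h3

end Disintegration

/-! ### Inclusion of the σ-fields. -/

section Inclusion

variable {Ω : Type*} {m : ℝ} {x : Ω → ℕ → ℝ} {ψ Z : ℕ+ → Ω → ℝ} {E : Set Ω}

/-- Where `ψ` consists of partial products, `Z` is a function of `ψ`. -/
theorem traceOn_history_le (hψ : ∀ ω ∈ E, ∀ n : ℕ+, ψ n ω = partialProd (x ω) n)
    (hZ : ∀ ω ∈ E, ∀ n : ℕ+, Z n ω = partialProdSum (x ω) n / (m * partialProd (x ω) n))
    (n : ℕ+) : traceOn (history Z n) E ≤ traceOn (history ψ n) E := by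
  have hmeas : ∀ k ≤ n, Measurable[traceOn (history ψ n) E] fun ω : E => ψ k ω := fun k hk =>
    (measurable_history hk).comp (comap_measurable Subtype.val)
  -- The empty product `P_0 = 1` is not a value of `ψ`, whose index starts at `1`; it is treated
  -- apart as a constant.
  have hmeas0 : ∀ k ≤ (n : ℕ), Measurable[traceOn (history ψ n) E]
      fun ω : E => partialProd (x ω) k := by
    intro k hk
    cases k with
    | zero => simp only [partialProd, Finset.range_zero, Finset.prod_empty]; exact measurable_const
    | succ k =>
      have h : (fun ω : E => partialProd (x ω) (k + 1)) = fun ω : E => ψ k.succPNat ω := by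
        ext ω; rw [hψ ω ω.2]; rfl
      rw [h]
      exact hmeas _ (PNat.coe_le_coe _ _ |>.1 hk)
  rw [traceOn, history, MeasurableSpace.comap_iSup]
  refine iSup_le fun k => ?_
  rw [MeasurableSpace.comap_iSup]
  refine iSup_le fun hk => ?_
  rw [MeasurableSpace.comap_comp, ← measurable_iff_comap_le]
  have h : Z k ∘ Subtype.val = fun ω : E => (∑ l ∈ Finset.range k,
      partialProd (x ω) l * partialProd (x ω) (l + 1)) / (m * partialProd (x ω) k) := by
    ext ω; exact hZ ω ω.2 k
  have hk' : (k : ℕ) ≤ n := PNat.coe_le_coe _ _ |>.2 hk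
  rw [h]
  refine Measurable.div (Finset.measurable_fun_sum _ fun l hl => ?_) ((hmeas0 k hk').const_mul m)
  have hl := Finset.mem_range.1 hl
  exact (hmeas0 l (by omega)).mul (hmeas0 (l + 1) (by omega))

theorem ae_eq_of_preimage_val_eq [MeasurableSpace Ω] {P : Measure Ω} (hE : ∀ᵐ ω ∂P, ω ∈ E)
    {s t : Set Ω} (h : (Subtype.val ⁻¹' s : Set E) = Subtype.val ⁻¹' t) : s =ᵐ[P] t := by
  filter_upwards [hE] with ω hω
  exact propext (Set.ext_iff.1 h ⟨ω, hω⟩)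

end Inclusion

/-! ### The main theorem. -/

theorem mainTheorem4 {Ω : Type*} [MeasurableSpace Ω] (P : Measure Ω) [IsProbabilityMeasure P]
    (m : ℕ) (hm : 1 ≤ m)
    (β : Ω → ℕ+ → ℝ) (hβ : Measurable β)
    (hlaw : IsBetaLaw (lineWeight (m : ℝ)) (P.map β))
    (ψ : ℕ+ → Ω → ℝ) (hψ : ∀ n ω, ψ n ω = psi (m : ℝ) (β ω) n)
    (Z : ℕ+ → Ω → ℝ) (hZ : ∀ n ω, Z n ω = zRatio (m : ℝ) (β ω) n)
    (E : Set Ω) (hE : E = {ω | ∀ n, (boxOperator (m : ℝ) (β ω) n).PosDef}) :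
    -- almost surely all the restricted operators are positive definite, hence invertible
    (∀ᵐ ω ∂P, ω ∈ E) ∧
    -- (i) strict inclusion: on the event where the objects are defined, and up to null sets
    (∀ n : ℕ+,
      traceOn (history Z n) E < traceOn (history ψ n) E ∧
      eventuallyMeasurableSpace (history Z n) (ae P) <
        eventuallyMeasurableSpace (history ψ n) (ae P)) ∧
    -- (ii) `Z` is Markov, with an explicit transition
    (IsMarkovProcess P Z ∧
      ∀ n : ℕ+, HasCondLaw P (history Z n) (Z (n + 1)) fun ω =>
        (inverseGaussian (1 / (m + 1 / Z n ω)) 1).map fun x => Z n ω / m * (1 / x)) ∧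
    -- (iii) conditional law of `ψ` given the past of `Z`
    (∀ n : ℕ+, HasCondLaw P (history Z n) (ψ n) fun ω => inverseGaussian 1 (1 / Z n ω)) := by
  have hm0 : (0 : ℝ) < m := by exact_mod_cast hm
  let X : (ℕ+ → ℝ) → ℕ → ℝ := fun b => pivotRatio m fun k => b k.succPNat
  have mX : Measurable X := (measurable_pivotRatio m).comp (by fun_prop)
  let x : Ω → ℕ → ℝ := fun ω => X (β ω)
  have hx : Measurable x := mX.comp hβ
  have hxlaw : P.map x = Measure.infinitePi fun _ : ℕ => inverseGaussian 1 m := by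
    rw [← hlaw.map_pivotRatio hm0, Measure.map_map mX hβ]
    rfl
  have mψ : ∀ n, Measurable (ψ n) := fun n => by
    rw [show ψ n = fun ω => psi m (β ω) n from funext (hψ n)]
    exact (measurable_psi m n).comp hβ
  have mZ : ∀ n, Measurable (Z n) := fun n => by
    rw [show Z n = fun ω => zRatio m (β ω) n from funext (hZ n)]
    exact (measurable_zRatio m n).comp hβ
  have hEx : ∀ᵐ ω ∂P, ω ∈ E := by
    filter_upwards [ae_pos_of_map_eq hm0 hx hxlaw] with ω hω
    rw [hE]
    exact (posDef_boxOperator_iff hm0).2 hω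
  have hψE : ∀ ω ∈ E, ∀ n : ℕ+, ψ n ω = partialProd (x ω) n := fun ω hω n => by
    rw [hE] at hω
    rw [hψ, psi_eq hm0 hω]
  have hZE : ∀ ω ∈ E, ∀ n : ℕ+, Z n ω = partialProdSum (x ω) n / (m * partialProd (x ω) n) :=
    fun ω hω n => by
      rw [hE] at hω
      rw [hZ, zRatio_eq hm0 hω]
  have hψ' : ∀ᵐ ω ∂P, ∀ n : ℕ+, ψ n ω = partialProd (x ω) n := hEx.mono hψE
  have hZ' : ∀ᵐ ω ∂P, ∀ n : ℕ+,
      Z n ω = partialProdSum (x ω) n / (m * partialProd (x ω) n) := hEx.mono hZE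
  have htrans := hasCondLaw_zRatio_succ hm0 hx hxlaw hψ' hZ' mZ
  refine ⟨hEx, fun n => ?_, ⟨?_, htrans⟩, hasCondLaw_psi hm0 hx hxlaw hψ' hZ' mψ mZ⟩
  · have hle := traceOn_history_le hψE hZE n
    have hS : MeasurableSet[history ψ n] (ψ n ⁻¹' Set.Ioi 1) :=
      measurable_history le_rfl measurableSet_Ioi
    have hnot : ∀ A, MeasurableSet[history Z n] A → ¬ ψ n ⁻¹' Set.Ioi 1 =ᵐ[P] A := fun A hA =>
      not_ae_eq_preimage_psi hm0 hx hxlaw hψ' hZ' mψ mZ n hA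
    refine ⟨lt_of_le_not_ge hle fun hge => ?_, lt_of_le_not_ge ?_ fun hge => ?_⟩
    · obtain ⟨A, hA, hAe⟩ := hge _ ⟨_, hS, rfl⟩
      exact hnot A hA (ae_eq_of_preimage_val_eq hEx hAe.symm)
    -- Since `E` has full measure, the inclusion of traces on `E` yields the inclusion up to null
    -- sets.
    · rintro s ⟨t, ht, hst⟩
      obtain ⟨t', ht', he⟩ := hle _ ⟨t, ht, rfl⟩
      exact ⟨t', ht', hst.trans (ae_eq_of_preimage_val_eq hEx he.symm)⟩
    · obtain ⟨A, hA, hAe⟩ := hge _ ⟨_, hS, Filter.EventuallyEq.rfl⟩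
      exact hnot A hA hAe
  · exact isMarkovProcess_of_hasCondLaw mZ (fun B hB => measurable_transition m hB) htrans
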